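/- Let $R$ be a ring and let $(X,d)$ be an unbounded metric space. For a set $Y$ let $C^n(Y;R)$ be the $R$-module of all functions $\varphi\colon Y^{n+1}\to R$, with coboundary $(d\varphi)(x_0,\dots,x_{n+1})=\sum_{i=0}^{n+1}(-1)^i\varphi(x_0,\dots,\widehat{x_i},\dots,x_{n+1})$. The coarse cohomology $HX^*(X;R)$ is the cohomology of the subcomplex $CX^*(X;R)\subset C^*(X;R)$ of those $\varphi$ for which, for every $r$, the set of points of $\{\varphi\neq 0\}\subset X^{n+1}$ at distance less than $r$ from the diagonal (in the supremum metric) is bounded. For a topological space $Y$, let $C^n_0(Y;R)$ be the module of those $\varphi\in C^n(Y;R)$ for which the closure of $\{\varphi\ne 0\}$ in $Y^{n+1}$ does not meet the diagonal, and let $\widetilde H^n(Y;R)$, $n\ge 0$, be the reduced Alexander–Spanier cohomology, i.e. the cohomology of $C^*(Y;R)/C^*_0(Y;R)$ augmented by the map $R\to C^0(Y;R)/C^0_0(Y;R)$ sending an element to the corresponding constant function. Suppose that $X$ is uniformly contractible at infinity: there are non-decreasing functions $\rho,\mu\colon[0,\infty)\to[0,\infty)$ and a point $b_0\in X$ such that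 every nonempty bounded set $B\subset X$ of diameter $r$ with $d(b_0,B)\ge\mu(r)$ is contractible inside a set $C\supset B$ of diameter at most $\rho(r)$ (that is, the inclusion $B\to C$ is homotopic in $C$ to a constant map). Then for every $b\in X$ there are isomorphisms of $R$-modules $$HX^0(X;R)=0,\qquad HX^{n}(X;R)\;\cong\;\varinjlim_{r}\,\widetilde H^{\,n-1}(X-N_r(b);R)\quad\text{for all } n\ge 1,$$ where $N_r(b)$ is the ball of radius $r$ about $b$ and the direct limit is taken over $r\to\infty$ with respect to the restriction maps. -/

import Mathlib

open scoped NNReal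

namespace CoarseCohomology

universe u v

/-! ### The complex of all cochains -/

/-- `n`-cochains on `X`: all functions `X^{n+1} → R`, a left `R`-module under pointwise operations. -/
def Cochain (R : Type v) (X : Type u) (n : ℕ) : Type (max u v) :=
  (Fin (n + 1) → X) → R

instance (R : Type v) [Ring R] (X : Type u) (n : ℕ) : AddCommGroup (Cochain R X n) :=
  inferInstanceAs (AddCommGroup ((Fin (n + 1) → X) → R))

instance (R : Type v) [Ring R] (X : Type u) (n : ℕ) : Module R (Cochain R X n) :=
  inferInstanceAs (Module R ((Fin (n + 1) → X) → R))

/-- The coboundary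
`(d φ)(x₀, …, xₙ₊₁) = ∑ᵢ (-1)ⁱ φ(x₀, …, x̂ᵢ, …, xₙ₊₁)`. -/
def coboundary (R : Type v) [Ring R] (X : Type u) (n : ℕ) :
    Cochain R X n →ₗ[R] Cochain R X (n + 1) where
  toFun φ := fun σ => ∑ i : Fin (n + 2), (-1 : ℤ) ^ (i : ℕ) • φ (i.removeNth σ)
  map_add' φ ψ := by
    funext σ
    change ∑ i : Fin (n + 2), (-1 : ℤ) ^ (i : ℕ) • (φ (i.removeNth σ) + ψ (i.removeNth σ)) =
      ∑ i : Fin (n + 2), (-1 : ℤ) ^ (i : ℕ) • φ (i.removeNth σ) +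
        ∑ i : Fin (n + 2), (-1 : ℤ) ^ (i : ℕ) • ψ (i.removeNth σ)
    simp only [smul_add, Finset.sum_add_distrib]
  map_smul' c φ := by
    funext σ
    change ∑ i : Fin (n + 2), (-1 : ℤ) ^ (i : ℕ) • (c • φ (i.removeNth σ)) =
      c • ∑ i : Fin (n + 2), (-1 : ℤ) ^ (i : ℕ) • φ (i.removeNth σ)
    rw [Finset.smul_sum]
    exact Finset.sum_congr rfl fun i _ => smul_comm _ _ _

theorem exists_face_of_mem_support {R : Type v} [Ring R] {X : Type u} {n : ℕ}
    {φ : Cochain R X n} {σ : Fin (n + 2) → X}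
    (h : σ ∈ Function.support (coboundary R X n φ)) :
    ∃ i : Fin (n + 2), i.removeNth σ ∈ Function.support φ := by
  by_contra! hn
  have h0 : ∑ i : Fin (n + 2), (-1 : ℤ) ^ (i : ℕ) • φ (i.removeNth σ) = 0 :=
    Finset.sum_eq_zero fun i _ => by rw [Function.notMem_support.1 (hn i), smul_zero]
  exact h h0

theorem coboundary_coboundary {R : Type v} [Ring R] {X : Type u} {n : ℕ} (φ : Cochain R X n) :
    coboundary R X (n + 1) (coboundary R X n φ) = 0 := by
  funext σ
  change ∑ i : Fin (n + 3), (-1 : ℤ) ^ (i : ℕ) •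
    ∑ j : Fin (n + 2), (-1 : ℤ) ^ (j : ℕ) • φ (j.removeNth (i.removeNth σ)) = 0
  simp only [Finset.smul_sum, smul_smul]
  rw [← Finset.sum_product']
  refine Finset.sum_involution (fun p _ => (p.1.succAbove p.2, p.2.predAbove p.1)) ?_ ?_ ?_ ?_
  · rintro ⟨i, j⟩ _
    have h1 := Fin.neg_one_pow_succAbove_add_predAbove (R := ℤ) i j
    have h2 : (j.removeNth (i.removeNth σ) : Fin (n + 1) → X) =
        (j.predAbove i).removeNth ((i.succAbove j).removeNth σ) := by
      funext k
      simp [Fin.removeNth, Fin.succAbove_succAbove_succAbove_predAbove]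
    simp only [← pow_add]
    rw [← h2, ← add_smul, h1]
    simp
  · rintro ⟨i, j⟩ _ _ h
    exact Fin.succAbove_ne i j (congrArg Prod.fst h)
  · simp
  · rintro ⟨i, j⟩ _
    simp [Fin.succAbove_succAbove_predAbove, Fin.predAbove_predAbove_succAbove]

/-- The diagonal of `X^{n+1}`. -/
def diagonal (X : Type u) (n : ℕ) : Set (Fin (n + 1) → X) :=
  Set.range fun (x : X) (_ : Fin (n + 1)) => x

/-- Cocycles modulo coboundaries. -/
abbrev Subquotient {R : Type v} [Ring R] {M : Type u} [AddCommGroup M] [Module R M]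
    (Z B : Submodule R M) : Type u :=
  Z ⧸ B.submoduleOf Z

/-! ### Coarse cohomology

`Fin (n + 1) → X` carries the supremum metric, so repeating the last coordinate embeds it
isometrically in the space of eventually constant sequences with the supremum metric,
and the distance of a simplex to the diagonal is the same in both. -/

section Coarse

variable (R : Type v) [Ring R] (X : Type u) [MetricSpace X]

/-- Coarse cochains: for every `r` the part of the support in the `r`-neighbourhood of the diagonal
is bounded. -/
def coarseCochain (n : ℕ) : Submodule R (Cochain R X n) where
  carrier := {φ | ∀ r : ℝ, Bornology.IsBounded
    (Function.support φ ∩ Metric.thickening r (diagonal X n))}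
  zero_mem' r := by
    have h : Function.support (0 : Cochain R X n) = ∅ := Function.support_zero
    simp [h]
  add_mem' {φ ψ} hφ hψ r := by
    refine ((hφ r).union (hψ r)).subset ?_
    rw [← Set.union_inter_distrib_right]
    exact Set.inter_subset_inter_left _ (Function.support_add φ ψ)
  smul_mem' c φ hφ r :=
    (hφ r).subset (Set.inter_subset_inter_left _ (Function.support_const_smul_subset c φ))

variable {R X}

theorem coboundary_mem_coarseCochain {n : ℕ} {φ : Cochain R X n}
    (hφ : φ ∈ coarseCochain R X n) :
    coboundary R X n φ ∈ coarseCochain R X (n + 1) := by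
  intro r
  obtain ⟨C, hC⟩ := Metric.isBounded_iff.1 (hφ r)
  -- a simplex near the diagonal is close to each of its faces
  have key : ∀ σ ∈ Function.support (coboundary R X n φ) ∩ Metric.thickening r (diagonal X (n + 1)),
      ∃ τ ∈ Function.support φ ∩ Metric.thickening r (diagonal X n),
        ∀ j : Fin (n + 2), dist (σ j) (τ 0) ≤ 2 * r := by
    rintro σ ⟨hσ, hσr⟩
    obtain ⟨i, hi⟩ := exists_face_of_mem_support hσ
    obtain ⟨_, ⟨x, rfl⟩, hx⟩ := Metric.mem_thickening_iff.1 hσr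
    have hr : 0 < r := dist_nonneg.trans_lt hx
    have hx' : ∀ j, dist (σ j) x < r := (dist_pi_lt_iff hr).1 hx
    refine ⟨i.removeNth σ, ⟨hi, Metric.mem_thickening_iff.2 ⟨_, ⟨x, rfl⟩, ?_⟩⟩, fun j => ?_⟩
    · exact (dist_pi_lt_iff hr).2 fun j => hx' _
    · calc dist (σ j) (i.removeNth σ 0) ≤ dist (σ j) x + dist (i.removeNth σ 0) x :=
            dist_triangle_right _ _ _
        _ ≤ 2 * r := by
            have h1 := hx' j
            have h2 : dist (i.removeNth σ 0) x < r := hx' _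
            linarith
  refine Metric.isBounded_iff.2 ⟨2 * r + max C 0 + 2 * r, fun σ hσ σ' hσ' => ?_⟩
  obtain ⟨τ, hτ, h1⟩ := key σ hσ
  obtain ⟨τ', hτ', h2⟩ := key σ' hσ'
  have h3 : dist (τ 0) (τ' 0) ≤ max C 0 :=
    ((dist_le_pi_dist τ τ' 0).trans (hC hτ hτ')).trans (le_max_left _ _)
  have hr : 0 ≤ 2 * r := dist_nonneg.trans (h1 0)
  refine (dist_pi_le_iff (by positivity)).2 fun j => ?_
  calc dist (σ j) (σ' j) ≤ dist (σ j) (τ 0) + dist (τ 0) (τ' 0) + dist (τ' 0) (σ' j) :=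
        dist_triangle4 _ _ _ _
    _ ≤ 2 * r + max C 0 + 2 * r := by
        have := h1 j
        have := h2 j
        rw [dist_comm (τ' 0)]
        linarith

variable (R X)

/-- The coboundary of the coarse complex. -/
def coarseD (n : ℕ) : coarseCochain R X n →ₗ[R] coarseCochain R X (n + 1) :=
  (coboundary R X n).restrict fun _ h => coboundary_mem_coarseCochain h

/-- Coarse `n`-coboundaries; there is nothing in degree `-1`. -/
def coarseBoundaries : (n : ℕ) → Submodule R (coarseCochain R X n)
  | 0 => ⊥
  | n + 1 => LinearMap.range (coarseD R X n)

/-- Coarse cohomology `HXⁿ(X; R)`. -/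
abbrev HX (n : ℕ) : Type (max u v) :=
  Subquotient (LinearMap.ker (coarseD R X n)) (coarseBoundaries R X n)

end Coarse

/-! ### Reduced Alexander–Spanier cohomology -/

section AlexanderSpanier

variable (R : Type v) [Ring R] (X : Type u) [TopologicalSpace X]

/-- Locally zero cochains: the closure of the support does not meet the diagonal. -/
def locallyZero (n : ℕ) : Submodule R (Cochain R X n) where
  carrier := {φ | diagonal X n ∩ closure (Function.support φ) = ∅}
  zero_mem' := by
    have h : Function.support (0 : Cochain R X n) = ∅ := Function.support_zero
    simp [h]
  add_mem' {φ ψ} hφ hψ := by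
    have h := closure_mono (Function.support_add φ ψ)
    rw [closure_union] at h
    refine Set.subset_empty_iff.1 ((Set.inter_subset_inter_right _ h).trans ?_)
    rw [Set.inter_union_distrib_left, hφ, hψ, Set.union_empty]
  smul_mem' c φ hφ :=
    Set.subset_empty_iff.1 ((Set.inter_subset_inter_right _
      (closure_mono (Function.support_const_smul_subset c φ))).trans hφ.subset)

/-- Pulling cochains back along a map. -/
def pullback {X Y : Type u} (f : X → Y) (n : ℕ) : Cochain R Y n →ₗ[R] Cochain R X n :=
  LinearMap.funLeft R R fun σ : Fin (n + 1) → X => f ∘ σ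

variable {R X}

theorem coboundary_mem_locallyZero {n : ℕ} {φ : Cochain R X n} (hφ : φ ∈ locallyZero R X n) :
    coboundary R X n φ ∈ locallyZero R X (n + 1) := by
  refine Set.eq_empty_iff_forall_notMem.2 ?_
  rintro _ ⟨⟨x, rfl⟩, hx⟩
  have hsub : Function.support (coboundary R X n φ) ⊆
      ⋃ i : Fin (n + 2), (fun σ : Fin (n + 2) → X => i.removeNth σ) ⁻¹' Function.support φ :=
    fun σ hσ => Set.mem_iUnion.2 (exists_face_of_mem_support hσ)
  have h := closure_mono hsub hx
  rw [closure_iUnion_of_finite] at h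
  obtain ⟨i, hi⟩ := Set.mem_iUnion.1 h
  have hc : Continuous fun σ : Fin (n + 2) → X => i.removeNth σ :=
    continuous_pi fun j => continuous_apply _
  exact (Set.eq_empty_iff_forall_notMem.1 hφ) (fun _ => x)
    ⟨⟨x, rfl⟩, hc.closure_preimage_subset _ hi⟩

theorem pullback_mem_locallyZero {X Y : Type u} [TopologicalSpace X] [TopologicalSpace Y]
    (f : C(X, Y)) {n : ℕ} {φ : Cochain R Y n} (hφ : φ ∈ locallyZero R Y n) :
    pullback R f n φ ∈ locallyZero R X n := by
  refine Set.eq_empty_iff_forall_notMem.2 ?_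
  rintro _ ⟨⟨x, rfl⟩, hx⟩
  have hc : Continuous fun σ : Fin (n + 1) → X => f ∘ σ :=
    continuous_pi fun j => f.continuous.comp (continuous_apply j)
  exact (Set.eq_empty_iff_forall_notMem.1 hφ) (fun _ => f x)
    ⟨⟨f x, rfl⟩, hc.closure_preimage_subset (Function.support φ) hx⟩

variable (R X)

/-- Alexander–Spanier `n`-cochains: all cochains modulo the locally zero ones. -/
abbrev ASCochain (n : ℕ) : Type (max u v) := Cochain R X n ⧸ locallyZero R X n

/-- The coboundary of the Alexander–Spanier complex. -/
def asD (n : ℕ) : ASCochain R X n →ₗ[R] ASCochain R X (n + 1) :=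
  Submodule.mapQ _ _ (coboundary R X n) fun _ h => coboundary_mem_locallyZero h

/-- The augmentation `R → C⁰_AS(X; R)`, sending `c` to the class of the constant cochain `c`. -/
def asAugmentation : R →ₗ[R] ASCochain R X 0 :=
  (locallyZero R X 0).mkQ ∘ₗ LinearMap.pi fun _ => LinearMap.id

/-- `n`-coboundaries of the augmented Alexander–Spanier complex
`R → C⁰_AS → C¹_AS → ⋯`. -/
def asReducedBoundaries : (n : ℕ) → Submodule R (ASCochain R X n)
  | 0 => LinearMap.range (asAugmentation R X)
  | n + 1 => LinearMap.range (asD R X n)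

/-- Reduced Alexander–Spanier cohomology `H̃ⁿ(X; R)` for `n ≥ 0`. -/
abbrev ReducedAS (n : ℕ) : Type (max u v) :=
  Subquotient (LinearMap.ker (asD R X n)) (asReducedBoundaries R X n)

/-- The map on Alexander–Spanier cochains induced by a continuous map. -/
def asPullback {X Y : Type u} [TopologicalSpace X] [TopologicalSpace Y] (f : C(X, Y)) (n : ℕ) :
    ASCochain R Y n →ₗ[R] ASCochain R X n :=
  Submodule.mapQ _ _ (pullback R f n) fun _ h => pullback_mem_locallyZero f h

variable {R} {X Y : Type u} [TopologicalSpace X] [TopologicalSpace Y] (f : C(X, Y)) (n : ℕ)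

theorem asD_asPullback (a : ASCochain R Y n) :
    asD R X n (asPullback R f n a) = asPullback R f (n + 1) (asD R Y n a) := by
  obtain ⟨φ, rfl⟩ := Submodule.Quotient.mk_surjective _ a
  rfl

theorem asPullback_mem_ker (a : ASCochain R Y n) (ha : a ∈ LinearMap.ker (asD R Y n)) :
    asPullback R f n a ∈ LinearMap.ker (asD R X n) := by
  rw [LinearMap.mem_ker] at ha ⊢
  rw [asD_asPullback, ha, map_zero]

theorem asPullback_mem_boundaries (a : ASCochain R Y n) (ha : a ∈ asReducedBoundaries R Y n) :
    asPullback R f n a ∈ asReducedBoundaries R X n := by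
  cases n with
  | zero =>
    obtain ⟨c, rfl⟩ := ha
    exact ⟨c, rfl⟩
  | succ n =>
    obtain ⟨b, rfl⟩ := ha
    exact ⟨asPullback R f n b, asD_asPullback f n b⟩

variable (R)

/-- The map on reduced Alexander–Spanier cohomology induced by a continuous map. -/
def reducedASMap : ReducedAS R Y n →ₗ[R] ReducedAS R X n :=
  Submodule.mapQ _ _ ((asPullback R f n).restrict (asPullback_mem_ker f n))
    fun a ha => asPullback_mem_boundaries f n a.1 ha

end AlexanderSpanier

/-! ### The cohomology at infinity and the geometric hypothesis -/

section Infinity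

/-- The inclusion `X - N_s(b) → X - N_r(b)` for `r ≤ s`. -/
def complInclusion {X : Type u} [MetricSpace X] (b : X) {r s : ℝ≥0} (h : r ≤ s) :
    C(((Metric.ball b s)ᶜ : Set X), ((Metric.ball b r)ᶜ : Set X)) :=
  ⟨Set.inclusion (Set.compl_subset_compl.2 (Metric.ball_subset_ball h)), continuous_inclusion _⟩

/-- The direct limit over `r` of `H̃ⁿ(X - N_r(b); R)` under the restriction maps. -/
abbrev ReducedASAtInfinity (R : Type v) [Ring R] {X : Type u} [MetricSpace X] (b : X) (n : ℕ) :
    Type (max u v) :=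
  Module.DirectLimit (fun r : ℝ≥0 => ReducedAS R ((Metric.ball b r)ᶜ : Set X) n)
    fun _ _ h => reducedASMap R (complInclusion b h) n

/-- `B` is contractible inside `C`: the inclusion `B → C` is homotopic, as a map into `C`, to a
constant map. -/
def ContractibleInside {X : Type u} [TopologicalSpace X] (B C : Set X) : Prop :=
  ∃ h : B ⊆ C, ContinuousMap.Nullhomotopic
    (⟨Set.inclusion h, continuous_inclusion h⟩ : C(B, C))

/-- `X` is uniformly contractible at infinity: there are non-decreasing `ρ, μ : [0, ∞) → [0, ∞)`
and a basepoint `b` such that every set `B` of diameter `r` with `d(b, B) ≥ μ r` is contractible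
inside a set of diameter at most `ρ r`. (Nonemptiness and boundedness are spelled out because
`Metric.infDist` and `Metric.diam` have default values otherwise.) -/
def UniformlyContractibleAtInfinity (X : Type u) [MetricSpace X] : Prop :=
  ∃ ρ μ : ℝ≥0 → ℝ≥0, Monotone ρ ∧ Monotone μ ∧ ∃ b : X,
    ∀ (r : ℝ≥0) (B : Set X), B.Nonempty → Bornology.IsBounded B → Metric.diam B = r →
      (μ r : ℝ) ≤ Metric.infDist b B →
        ∃ C : Set X, Bornology.IsBounded C ∧ Metric.diam C ≤ ρ r ∧ ContractibleInside B C

end Infinity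

end CoarseCohomology

/-! Let `C` be the complex of all cochains, `CX` the coarse ones and `Z` (`zeroAtInfinity`) those
vanishing near the diagonal outside a bounded set, so that `CX ⊆ Z ⊆ C`. Coning off a point shows
that augmented `C` is acyclic, so coarse cohomology in degree `n + 1` is the reduced cohomology of
`C / CX` in degree `n`. A cochain on the complement of a ball extends to `X` by zero, and any two
extensions differ by an element of `Z`, so the direct limit is the reduced cohomology of `C / Z`. It
remains to compare `CX` with `Z`. They agree in degree `0`, and in positive degree a cochain of `Z`
with coarse coboundary becomes coarse after subtracting `dη` for some `η` in `Z`
(`exists_sub_coboundary_mem_coarseCochain`).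

That last claim is a Čech-type descent. To tuples `t` of at most `m` points one assigns cochains `E
t` on intersections of large balls about them, starting from `E [] = φ` and solving `d (E t) = ± ∑ ±
E (t minus one entry)` (`exists_descent`). The right side is a locally zero cocycle. Uniform
contractibility contracts an intersection of balls inside the intersection of larger balls, and
homotopy invariance then provides a locally zero primitive (`exists_listD_of_contractibleInside`).
The radii tend to infinity with the centres (`exists_radii`).

With `p` a bounded perturbation of the identity, `η (x₁, …, xₙ) = -∑ E (p x₁, …, p x_q) (x_q, …,
xₙ)` has coboundary `φ` on far away tuples of bounded size, because the sum telescopes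
(`listD_overlapSum`). Taking `p` with locally finite range leaves finitely many `E t` near each
point, which keeps `η` locally zero at infinity. -/

namespace CoarseCohomology

/-! ### Cochains on lists

A function on lists is a sum of cochains of all degrees `≥ -1`; the recursive form of the
coboundary makes the algebraic identities provable by induction. -/

section Lists

variable {X Y Z A : Type*} [AddCommGroup A]

/-- The coboundary of a function on lists: the alternating sum over the deletions of one entry. -/
def listD : (List X → A) → List X → A
  | _, [] => 0
  | f, a :: l => f l - listD (fun l' => f (a :: l')) l

@[simp] theorem listD_nil (f : List X → A) : listD f [] = 0 := rfl

theorem listD_cons (f : List X → A) (a : X) (l : List X) :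
    listD f (a :: l) = f l - listD (fun l' => f (a :: l')) l := rfl

theorem listD_congr {f g : List X → A} {l : List X}
    (h : ∀ t, t.Sublist l → t.length + 1 = l.length → f t = g t) : listD f l = listD g l := by
  induction l generalizing f g with
  | nil => rfl
  | cons a l ih =>
    rw [listD_cons, listD_cons, h l (List.sublist_cons_self a l) rfl]
    congr 1
    exact ih fun t ht hl => h _ (ht.cons_cons a) (by simp [hl])

@[simp] theorem listD_zero (l : List X) : listD (fun _ => (0 : A)) l = 0 := by
  induction l with
  | nil => rfl
  | cons a l ih => rw [listD_cons, ih, sub_zero]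

theorem listD_add (f g : List X → A) (l : List X) :
    listD (fun t => f t + g t) l = listD f l + listD g l := by
  induction l generalizing f g with
  | nil => simp
  | cons a l ih => simp only [listD_cons, ih]; abel

theorem listD_neg (f : List X → A) (l : List X) : listD (fun t => -f t) l = -listD f l := by
  induction l generalizing f with
  | nil => simp
  | cons a l ih => simp only [listD_cons, ih]; abel

theorem listD_sub (f g : List X → A) (l : List X) :
    listD (fun t => f t - g t) l = listD f l - listD g l := by
  simp only [sub_eq_add_neg, listD_add, listD_neg]

theorem listD_zsmul (k : ℤ) (f : List X → A) (l : List X) :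
    listD (fun t => k • f t) l = k • listD f l := by
  induction l generalizing f with
  | nil => simp
  | cons a l ih => simp only [listD_cons, ih, smul_sub]

theorem listD_sum {ι : Type*} (s : Finset ι) (f : ι → List X → A) (l : List X) :
    listD (fun t => ∑ i ∈ s, f i t) l = ∑ i ∈ s, listD (f i) l := by
  classical
  induction s using Finset.induction_on with
  | empty => simp
  | insert i s hi ih => simp only [Finset.sum_insert hi, listD_add, ih]

theorem listD_listD (f : List X → A) (l : List X) : listD (listD f) l = 0 := by
  induction l generalizing f with
  | nil => rfl
  | cons a l ih => simp only [listD_cons, listD_sub, ih]; abel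

theorem listD_comm (E : List X → List Y → A) (t : List X) (l : List Y) :
    listD (fun t' => listD (E t') l) t = listD (fun l' => listD (fun t' => E t' l') t) l := by
  induction t generalizing E with
  | nil => simp
  | cons a t ih => simp only [listD_cons, listD_sub, ih]

theorem listD_map (p : X → Y) (f : List Y → A) (l : List X) :
    listD (fun t => f (t.map p)) l = listD f (l.map p) := by
  induction l generalizing f with
  | nil => simp
  | cons a l ih => simp only [listD_cons, List.map_cons, ← ih]

/-- The prism operator of two maps. -/
def prism (u v : X → Y) : (List Y → A) → List X → A
  | _, [] => 0
  | f, a :: l => f (u a :: v a :: l.map v) - prism u v (fun l' => f (u a :: l')) l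

@[simp] theorem prism_nil (u v : X → Y) (f : List Y → A) : prism u v f [] = 0 := rfl

theorem prism_cons (u v : X → Y) (f : List Y → A) (a : X) (l : List X) :
    prism u v f (a :: l) =
      f (u a :: v a :: l.map v) - prism u v (fun l' => f (u a :: l')) l := rfl

theorem prism_sub (u v : X → Y) (f g : List Y → A) (l : List X) :
    prism u v (fun t => f t - g t) l = prism u v f l - prism u v g l := by
  induction l generalizing f g with
  | nil => simp
  | cons a l ih => simp only [prism_cons, ih]; abel

theorem listD_prism (u v : X → Y) (f : List Y → A) (l : List X) :
    listD (prism u v f) l = f (l.map v) - f (l.map u) - prism u v (listD f) l := by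
  induction l generalizing f with
  | nil => simp
  | cons a l ih =>
    have h := ih fun l' => f (u a :: l')
    have h2 := listD_map v (fun t => f (u a :: v a :: t)) l
    simp only [listD_cons, prism_cons, listD_sub, prism_sub, List.map_cons] at *
    rw [h, h2]
    abel

theorem prism_eq_zero {u v : X → Y} {f : List Y → A} {O : Set Y} {l : List X}
    (hu : ∀ x ∈ l, u x ∈ O) (hv : ∀ x ∈ l, v x ∈ O)
    (hf : ∀ t : List Y, (∀ y ∈ t, y ∈ O) → f t = 0) : prism u v f l = 0 := by
  induction l generalizing f with
  | nil => rfl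
  | cons a l ih =>
    simp only [List.mem_cons, forall_eq_or_imp] at hu hv
    rw [prism_cons, ih hu.2 hv.2, sub_zero]
    · refine hf _ ?_
      simp only [List.mem_cons, List.mem_map]
      rintro y (rfl | rfl | ⟨x, hx, rfl⟩)
      exacts [hu.1, hv.1, hv.2 x hx]
    · intro t ht
      refine hf _ ?_
      simp only [List.mem_cons]
      rintro y (rfl | hy)
      exacts [hu.1, ht y hy]

/-- A prism over a constant homotopy is degenerate but need not vanish for arbitrary cochains. This
form shows that it does vanish once `listD f` is zero on constant lists. -/
theorem prism_const {u v : X → Y} {c : Y} {f : List Y → A} {l : List X}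
    (hu : ∀ x ∈ l, u x = c) (hv : ∀ x ∈ l, v x = c) :
    prism u v f l = listD (fun t => f (c :: c :: t)) (l.map fun _ => c) := by
  induction l generalizing f with
  | nil => rfl
  | cons a l ih =>
    simp only [List.mem_cons, forall_eq_or_imp] at hu hv
    rw [prism_cons, ih hu.2 hv.2, hu.1, hv.1, List.map_congr_left hv.2]
    rfl

/-- The sum over `q ≥ 1` of the values `E (x₁, …, x_q) (x_q, …, xₙ)`. -/
def overlapSum : (List X → List X → A) → List X → A
  | _, [] => 0
  | E, a :: l => E [a] (a :: l) + overlapSum (fun t => E (a :: t)) l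

theorem overlapSum_cons (E : List X → List X → A) (a : X) (l : List X) :
    overlapSum E (a :: l) = E [a] (a :: l) + overlapSum (fun t => E (a :: t)) l := rfl

theorem overlapSum_sub (E F : List X → List X → A) (l : List X) :
    overlapSum (fun t l' => E t l' - F t l') l = overlapSum E l - overlapSum F l := by
  induction l generalizing E F with
  | nil => simp [overlapSum]
  | cons a l ih => simp only [overlapSum_cons, ih]; abel

theorem overlapSum_eq_zero {E : List X → List X → A} {x : List X}
    (h : ∀ t a l, x = t ++ a :: l → E (t ++ [a]) (a :: l) = 0) : overlapSum E x = 0 := by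
  induction x generalizing E with
  | nil => rfl
  | cons a x ih =>
    have h0 := h [] a x rfl
    rw [List.nil_append] at h0
    rw [overlapSum_cons, h0, zero_add]
    exact ih fun t b l hx => h (a :: t) b l (by rw [hx]; rfl)

/-- Write `a_q = E (x₁, …, x_q) (x_{q+1}, …, xₙ)`. In the `q`-th mixed term, deleting the shared
entry `x_q` from the first or the second list gives `(-1)^(q-1) a_{q-1} - (-1)^q a_q`. These
contributions telescope to the two boundary terms, and the other deletions are those of the overlap
sum itself. -/
theorem listD_overlapSum (E : List X → List X → A) (x : List X) :
    listD (overlapSum E) x =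
      overlapSum (fun t l => listD (fun t' => E t' l) t - (-1 : ℤ) ^ t.length • listD (E t) l) x
        - E [] x + (-1 : ℤ) ^ x.length • E x [] := by
  induction x generalizing E with
  | nil => simp [overlapSum]
  | cons a l ih =>
    have h : (fun (t : List X) (l : List X) => listD (fun t' => E t' l) (a :: t) -
        (-1 : ℤ) ^ (a :: t).length • listD (E (a :: t)) l) = fun t l => E t l -
          (listD (fun t' => E (a :: t') l) t - (-1 : ℤ) ^ t.length • listD (E (a :: t)) l) := by
      funext t l
      simp only [listD_cons, List.length_cons, pow_succ, mul_neg, mul_one, neg_smul]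
      abel
    rw [overlapSum_cons, h, overlapSum_sub, listD_cons]
    simp only [overlapSum_cons, listD_add, ih fun t => E (a :: t)]
    simp only [listD_cons, listD_nil, List.length_cons, List.length_nil, pow_succ, pow_zero,
      mul_neg, mul_one, neg_smul, one_smul, smul_sub]
    abel

theorem listD_ofFn (f : List X → A) {n : ℕ} (σ : Fin (n + 1) → X) :
    listD f (List.ofFn σ) =
      ∑ i : Fin (n + 1), (-1 : ℤ) ^ (i : ℕ) • f (List.ofFn (i.removeNth σ)) := by
  induction n generalizing f with
  | zero => simp [listD_cons]
  | succ n ih =>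
    conv_rhs => rw [Fin.sum_univ_succ]
    rw [List.ofFn_succ, listD_cons, ih, sub_eq_add_neg, ← Finset.sum_neg_distrib]
    congr 1
    · simp
      rfl
    · refine Finset.sum_congr rfl fun i _ => ?_
      rw [List.ofFn_succ]
      simp [Fin.removeNth, pow_succ]
      rfl

end Lists

end CoarseCohomology

namespace CoarseCohomology

open Filter Topology unitInterval

/-! ### Locally zero functions on lists -/

section LocallyZero

variable {X Y Z A : Type*} [AddCommGroup A]

/-- Every point of `B` has a neighbourhood `U` in `B` such that `f` vanishes on lists in `U`. -/
def LocallyZeroOn [TopologicalSpace X] (B : Set X) (f : List X → A) : Prop :=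
  ∀ x ∈ B, ∀ᶠ U in (𝓝[B] x).smallSets, ∀ l : List X, (∀ y ∈ l, y ∈ U) → f l = 0

theorem LocallyZeroOn.mono [TopologicalSpace X] {B C : Set X} {f : List X → A}
    (hf : LocallyZeroOn C f) (h : B ⊆ C) : LocallyZeroOn B f := fun x hx =>
  (hf x (h hx)).filter_mono (monotone_smallSets (nhdsWithin_mono x h))

/-- The empty list is a simplex of degree `-1`. That locally zero functions vanish on it is what
makes the theory reduced. -/
theorem LocallyZeroOn.nil [TopologicalSpace X] {B : Set X} {f : List X → A}
    (hf : LocallyZeroOn B f) (hB : B.Nonempty) : f [] = 0 := by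
  obtain ⟨x, hx⟩ := hB
  obtain ⟨U, hU⟩ := (hf x hx).exists
  exact hU [] (by simp)

/-- A function on a metric space with `δ > 0` small enough for each point can be found
continuously. -/
theorem exists_continuous_pos_of_local [MetricSpace Y] {P : Y → ℝ → Prop}
    (hP : ∀ y a b, a ≤ b → P y b → P y a) (h : ∀ y, ∃ δ > 0, ∀ᶠ z in 𝓝 y, P z δ) :
    ∃ ε : C(Y, ℝ), ∀ y, 0 < ε y ∧ P y (ε y) := by
  refine exists_continuous_forall_mem_convex_of_local_const (t := fun y => {δ | 0 < δ ∧ P y δ})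
    (fun y => Set.OrdConnected.convex ⟨fun a ha b hb c hc => ?_⟩) fun y => ?_
  · exact ⟨ha.1.trans_le hc.1, hP y _ _ hc.2 hb.2⟩
  · obtain ⟨δ, hδ, h⟩ := h y
    exact ⟨δ, h.mono fun z hz => ⟨hδ, hz⟩⟩

/-- A locally zero coboundary on `Z` becomes the coboundary of a locally zero function after
pulling back along a nullhomotopic map, up to a coboundary. -/
theorem exists_locallyZeroOn_map_sub_listD [MetricSpace Y] [TopologicalSpace Z] (f : C(Y, Z))
    (hf : f.Nullhomotopic) (α : List Z → A) (hα : LocallyZeroOn Set.univ (listD α)) :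
    ∃ β : List Y → A, LocallyZeroOn Set.univ (fun l => α (l.map f) - listD β l) := by
  classical
  obtain ⟨c, ⟨H⟩⟩ := hf
  -- `listD α` vanishes on lists of equal entries
  have hαc : ∀ n, listD α (List.replicate n c) = 0 := fun n => by
    obtain ⟨U, hU, h⟩ := eventually_smallSets.1 (hα c trivial)
    refine h U subset_rfl _ fun y hy => ?_
    rw [List.eq_of_mem_replicate hy]
    exact mem_of_mem_nhds (by simpa using hU)
  have hαs : ∀ z, ∃ O : Set Z, IsOpen O ∧ z ∈ O ∧
      ∀ l : List Z, (∀ y ∈ l, y ∈ O) → listD α l = 0 := fun z => by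
    obtain ⟨U, hU, h⟩ := eventually_smallSets.1 (hα z trivial)
    rw [nhdsWithin_univ] at hU
    obtain ⟨O, hO, hO', hz⟩ := mem_nhds_iff.1 hU
    exact ⟨O, hO', hz, h O hO⟩
  choose O hOo hOm hO using hαs
  -- `Y` need not be compact, so no uniform subdivision of the homotopy exists. The Lebesgue number
  -- along each track `I × {y}` gives a step length that varies continuously with `y`.
  obtain ⟨ε, hε⟩ := exists_continuous_pos_of_local
    (P := fun (y : Y) δ => ∀ s t : I, dist s t ≤ δ → ∃ z, H (s, y) ∈ O z ∧ H (t, y) ∈ O z)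
    (fun y a b hab h s t hst => h s t (hst.trans hab)) (fun y => by
      have hK : IsCompact ((Set.univ : Set I) ×ˢ ({y} : Set Y)) :=
        isCompact_univ.prod isCompact_singleton
      obtain ⟨δ, hδ, h⟩ := lebesgue_number_lemma_of_metric (c := fun z => H ⁻¹' O z) hK
        (fun z => (hOo z).preimage H.continuous)
        (fun q _ => Set.mem_iUnion.2 ⟨H q, hOm (H q)⟩)
      refine ⟨δ / 2, half_pos hδ, ?_⟩
      filter_upwards [Metric.ball_mem_nhds y hδ] with y' hy' s t hst
      obtain ⟨z, hz⟩ := h (s, y) (by simp)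
      refine ⟨z, @hz (s, y') ?_, @hz (t, y') ?_⟩
      · rw [Metric.mem_ball, Prod.dist_eq]
        simpa [hδ] using hy'
      · rw [Metric.mem_ball, Prod.dist_eq, max_lt_iff, dist_comm]
        exact ⟨by simpa using hst.trans_lt (half_lt_self hδ), hy'⟩)
  let τ : ℕ → Y → I := fun j y => Set.projIcc 0 1 zero_le_one (j * ε y)
  let u : ℕ → Y → Z := fun j y => H (τ j y, y)
  have hu : ∀ j, Continuous (u j) := fun j => by
    have : Continuous (τ j) := continuous_projIcc.comp (by fun_prop)
    exact H.continuous.comp (this.prodMk continuous_id)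
  have hclose : ∀ j y, ∃ z, u j y ∈ O z ∧ u (j + 1) y ∈ O z := fun j y => by
    refine (hε y).2 _ _ ?_
    rw [Subtype.dist_eq, Real.dist_eq]
    refine (Set.abs_projIcc_sub_projIcc zero_le_one).trans ?_
    push_cast
    rw [show (j : ℝ) * ε y - (j + 1) * ε y = -ε y by ring, abs_neg, abs_of_pos (hε y).1]
  have hu0 : ∀ y, u 0 y = f y := fun y => by simp [u, τ]
  -- The prisms join `f` to the constant map, whose pullback of `α` need not be locally zero. It is
  -- the coboundary of `γ`.
  let γ : List Y → A := fun l => α (c :: l.map fun _ => c)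
  let P : ℕ → List Y → A := fun j => prism (u j) (u (j + 1)) α
  have hγ : ∀ l, listD γ l = α (l.map fun _ => c) := fun l => by
    have h1 := listD_map (fun _ : Y => c) (fun t => α (c :: t)) l
    have h2 := hαc (l.length + 1)
    rw [List.replicate_succ, listD_cons, ← List.map_const', sub_eq_zero] at h2
    exact h1.trans h2.symm
  refine ⟨fun l => γ l - ∑ᶠ j, P j l, fun y _ => ?_⟩
  obtain ⟨J, hJ⟩ := exists_nat_gt (1 / ε y)
  have hJ' : 1 < J * ε y := by rwa [div_lt_iff₀ (hε y).1] at hJ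
  have hend : ∀ᶠ y' in 𝓝 y, ∀ j ≥ J, u j y' = c := by
    have : ContinuousAt (fun y' => J * ε y') y := by fun_prop
    filter_upwards [this.eventually (lt_mem_nhds hJ')] with y' hy' j hj
    have h1 : (1 : ℝ) ≤ j * ε y' := hy'.le.trans
      (mul_le_mul_of_nonneg_right (by exact_mod_cast hj) (hε y').1.le)
    simp [u, τ, Set.projIcc_of_right_le _ h1]
  have hmid : ∀ᶠ U in (𝓝 y).smallSets, ∀ j ∈ Finset.range J, ∀ l : List Y, (∀ x ∈ l, x ∈ U) →
      prism (u j) (u (j + 1)) (listD α) l = 0 := by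
    rw [Finset.eventually_all]
    intro j _
    obtain ⟨z, hz, hz'⟩ := hclose j y
    have h1 := (hu j).continuousAt.preimage_mem_nhds ((hOo z).mem_nhds hz)
    have h2 := (hu (j + 1)).continuousAt.preimage_mem_nhds ((hOo z).mem_nhds hz')
    refine eventually_smallSets.2 ⟨_, inter_mem h1 h2, fun U hU l hl => ?_⟩
    exact prism_eq_zero (fun x hx => (hU (hl x hx)).1) (fun x hx => (hU (hl x hx)).2) (hO z)
  rw [nhdsWithin_univ]
  filter_upwards [hmid, eventually_smallSets.2 ⟨_, hend, fun U hU => hU⟩] with U h1 h2 l hl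
  -- Once `j * ε ≥ 1` both ends of the prism are constant at `c`, so the infinite sum of prisms is
  -- locally a finite one.
  have hP : ∀ t : List Y, (∀ x ∈ t, x ∈ U) → ∀ j ≥ J, P j t = 0 := fun t ht j hj => by
    have h := hαc (t.length + 2)
    rw [List.replicate_succ, List.replicate_succ, listD_cons, listD_cons, sub_sub_cancel,
      ← List.map_const'] at h
    refine (prism_const (fun x hx => h2 (ht x hx) j hj)
      (fun x hx => h2 (ht x hx) (j + 1) (hj.trans j.le_succ))).trans h
  have hsum : ∀ t : List Y, (∀ x ∈ t, x ∈ U) →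
      ∑ᶠ j, P j t = ∑ j ∈ Finset.range J, P j t := fun t ht => by
    refine finsum_eq_sum_of_support_subset _ fun j hj => ?_
    by_contra hj'
    exact hj (hP t ht j (by simpa using hj'))
  have hD : listD (fun t => ∑ᶠ j, P j t) l = ∑ j ∈ Finset.range J, listD (P j) l := by
    rw [← listD_sum]
    exact listD_congr fun t ht _ => hsum t fun x hx => hl x (ht.subset hx)
  have htel : ∀ j ∈ Finset.range J, listD (P j) l = α (l.map (u (j + 1))) - α (l.map (u j)) :=
    fun j hj => by rw [listD_prism, h1 j hj l hl, sub_zero]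
  rw [listD_sub, hD, hγ, Finset.sum_congr rfl htel,
    Finset.sum_range_sub fun j => α (l.map (u j)), List.map_congr_left fun x _ => hu0 x,
    List.map_congr_left fun x hx => h2 (hl x hx) J le_rfl]
  abel

/-- The cone `ψ (c :: ·)` is a primitive of `ψ` on `C`, but not a locally zero one. As its
coboundary is locally zero, homotopy invariance makes it locally zero on `B` after subtracting a
coboundary, which leaves its own coboundary unchanged. -/
theorem exists_listD_of_contractibleInside [MetricSpace X] {B C : Set X}
    (hBC : ContractibleInside B C) (hB : B.Nonempty) {ψ : List X → A} (hψ : LocallyZeroOn C ψ)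
    (hd : ∀ l : List X, (∀ x ∈ l, x ∈ C) → listD ψ l = 0) :
    ∃ η : List X → A, LocallyZeroOn B η ∧ ∀ l : List X, (∀ x ∈ l, x ∈ B) → listD η l = ψ l := by
  classical
  obtain ⟨h, hnull⟩ := hBC
  obtain ⟨c, hcB⟩ := hB
  let α : List C → A := fun l => ψ (c :: l.map (↑))
  have hα : ∀ l : List X, (∀ x ∈ l, x ∈ C) → listD (fun t => ψ (c :: t)) l = ψ l := fun l hl => by
    have := hd (c :: l) (by simpa using ⟨h hcB, hl⟩)
    rw [listD_cons, sub_eq_zero] at this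
    exact this.symm
  have hα' : LocallyZeroOn Set.univ (listD α) := fun x _ => by
    obtain ⟨U, hU, hU'⟩ := eventually_smallSets.1 (hψ x x.2)
    rw [nhdsWithin_univ]
    refine eventually_smallSets.2 ⟨_, preimage_coe_mem_nhds_subtype.2 hU, fun V hV l hl => ?_⟩
    rw [show listD α l = _ from listD_map (fun x : C => (x : X)) (fun t => ψ (c :: t)) l, hα]
    · refine hU' U subset_rfl _ fun y hy => ?_
      obtain ⟨z, hz, rfl⟩ := List.mem_map.1 hy
      exact hV (hl z hz)
    · intro y hy
      obtain ⟨z, -, rfl⟩ := List.mem_map.1 hy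
      exact z.2
  obtain ⟨β, hβ⟩ := exists_locallyZeroOn_map_sub_listD _ hnull α hα'
  let r : X → B := fun x => if hx : x ∈ B then ⟨x, hx⟩ else ⟨c, hcB⟩
  have hr : ∀ l : List X, (∀ x ∈ l, x ∈ B) → (l.map r).map (fun x : B => (x : X)) = l := fun l hl => by
    rw [List.map_map]
    refine (List.map_congr_left fun x hx => ?_).trans (List.map_id l)
    simp [r, hl x hx]
  refine ⟨fun l => ψ (c :: l) - listD (fun t => β (t.map r)) l, fun x hx => ?_, fun l hl => ?_⟩
  · have := hβ ⟨x, hx⟩ trivial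
    rw [nhdsWithin_univ] at this
    obtain ⟨U, hU, hU'⟩ := eventually_smallSets.1 this
    obtain ⟨V, hV, hVU⟩ := mem_nhds_subtype _ _ _ |>.1 hU
    refine eventually_smallSets.2 ⟨V ∩ B, inter_mem (mem_nhdsWithin_of_mem_nhds hV) self_mem_nhdsWithin, fun W hW l hl => ?_⟩
    have hlB : ∀ x ∈ l, x ∈ B := fun y hy => (hW (hl y hy)).2
    have h1 := hU' U subset_rfl (l.map r) fun y hy => by
      obtain ⟨z, hz, rfl⟩ := List.mem_map.1 hy
      apply hVU
      simpa [r, hlB z hz] using (hW (hl z hz)).1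
    change ψ (c :: l) - listD (fun t => β (t.map r)) l = 0
    rw [listD_map]
    refine Eq.trans (congrArg (· - listD β (l.map r)) ?_) h1
    change _ = ψ (c :: List.map (fun x : C => (x : X)) (List.map (Set.inclusion h) (l.map r)))
    rw [List.map_map]
    exact congrArg (fun t => ψ (c :: t)) (hr l hlB).symm
  · rw [listD_sub, listD_listD, sub_zero, hα l fun x hx => h (hl x hx)]

end LocallyZero

end CoarseCohomology

namespace CoarseCohomology

open Filter Topology Bornology

/-! ### Making cochains that are locally zero at infinity coarse -/

section Glue

variable {X A : Type*} [AddCommGroup A] [MetricSpace X]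

/-- Vanishing on all lists in a neighbourhood of each point far away. -/
def LocallyZeroAtInfinity (f : List X → A) : Prop :=
  ∀ᶠ x in cobounded X, ∀ᶠ U in (𝓝 x).smallSets, ∀ l : List X, (∀ y ∈ l, y ∈ U) → f l = 0

/-- Vanishing on all lists of bounded size that are far away. -/
def CoarselyZero (f : List X → A) : Prop :=
  ∀ r : ℝ, ∀ᶠ a in cobounded X, ∀ l : List X, (∀ y ∈ l, y ∈ Metric.ball a r) → f l = 0

theorem eventually_forall_ball {P : X → Prop} (h : ∀ᶠ x in cobounded X, P x) (r : ℝ) :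
    ∀ᶠ a in cobounded X, ∀ x ∈ Metric.ball a r, P x := by
  rcases isEmpty_or_nonempty X with hX | ⟨⟨b⟩⟩
  · exact Eventually.of_forall fun a => (hX.false a).elim
  have h' : IsBounded {x | ¬ P x} := by
    rw [← isCobounded_compl_iff]
    rw [isCobounded_def]
    filter_upwards [h] with x hx
    simpa using hx
  obtain ⟨s, hs⟩ := h'.subset_ball b
  filter_upwards [(Metric.tendsto_dist_right_cobounded_atTop b).eventually (eventually_ge_atTop (s + r))]
    with a ha x hx
  by_contra hP
  have h1 : dist x b < s := hs hP
  have h2 : dist x a < r := hx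
  have h3 := dist_triangle_left a b x
  linarith

/-- Paracompactness: refine the cover by unit balls to a locally finite one indexed by the centres,
and send each point to the index of a member containing it. -/
theorem exists_approximation_locally_finite_range (X : Type*) [MetricSpace X] :
    ∃ p : X → X, (∀ x, dist (p x) x < 1) ∧ ∀ x, ∃ U ∈ 𝓝 x, (p '' U).Finite := by
  obtain ⟨v, -, hv, hfin, hsub⟩ := precise_refinement (fun x : X => Metric.ball x 1)
    (fun _ => Metric.isOpen_ball)
    (Set.eq_univ_of_forall fun x => Set.mem_iUnion.2 ⟨x, Metric.mem_ball_self one_pos⟩)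
  have h : ∀ x, ∃ i, x ∈ v i := fun x => Set.mem_iUnion.1 (hv.symm ▸ Set.mem_univ x)
  choose p hp using h
  refine ⟨p, fun x => ?_, fun x => ?_⟩
  · rw [dist_comm]
    exact hsub _ (hp x)
  · obtain ⟨U, hU, hf⟩ := hfin x
    refine ⟨U, hU, hf.subset ?_⟩
    rintro _ ⟨y, hy, rfl⟩
    exact ⟨y, hp y, hy⟩

/-- Diagonal choice: `κ a` is the largest `k ≤ dist a b` for which `Q k a` holds. The value `0`
means that no positive `k` was found. -/
theorem exists_scale [Nonempty X] {Q : ℕ → X → Prop} (hQ : ∀ k, ∀ᶠ a in cobounded X, Q k a) :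
    ∃ κ : X → ℕ, Tendsto κ (cobounded X) atTop ∧ ∀ a, κ a ≠ 0 → Q (κ a) a := by
  classical
  obtain ⟨b⟩ := ‹Nonempty X›
  refine ⟨fun a => Nat.findGreatest (fun k => Q k a) ⌊dist a b⌋₊, tendsto_atTop.2 fun k => ?_,
    fun a ha => Nat.findGreatest_of_ne_zero rfl ha⟩
  filter_upwards [hQ k, (Metric.tendsto_dist_right_cobounded_atTop b).eventually
    (eventually_ge_atTop (k : ℝ))] with a h1 h2
  exact Nat.le_findGreatest (Nat.le_floor h2) h1

/-- One set `C` serves all balls containing `B` at once. This is needed for intersections of balls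
with different centres and radii. -/
theorem UniformlyContractibleAtInfinity.exists_contractibleInside
    (hc : UniformlyContractibleAtInfinity X) :
    ∃ ρ : ℝ → ℝ, (∀ r, r ≤ ρ r) ∧ ∀ r, ∀ᶠ a in cobounded X, ∀ B : Set X, B.Nonempty →
      B ⊆ Metric.ball a r →
        ∃ C, ContractibleInside B C ∧ ∀ a' r', B ⊆ Metric.ball a' r' → C ⊆ Metric.ball a' (ρ r') := by
  obtain ⟨ρ, μ, hρ, hμ, b, h⟩ := hc
  have hdiam : ∀ {B : Set X} {a : X} {r : ℝ}, B.Nonempty → B ⊆ Metric.ball a r →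
      Metric.diam B ≤ 2 * r := fun {B a r} ⟨y, hy⟩ hB =>
    (Metric.diam_mono hB Metric.isBounded_ball).trans
      (Metric.diam_ball (dist_nonneg.trans (hB hy).le))
  refine ⟨fun r => r + ρ (2 * r).toNNReal + 1, fun r => ?_, fun r => ?_⟩
  · change r ≤ r + (ρ (2 * r).toNNReal : ℝ) + 1
    linarith [NNReal.coe_nonneg (ρ (2 * r).toNNReal)]
  filter_upwards [(Metric.tendsto_dist_right_cobounded_atTop b).eventually
    (eventually_ge_atTop (r + μ (2 * r).toNNReal))] with a ha B hBne hB
  obtain ⟨C, hCb, hCd, hBC⟩ := h ⟨Metric.diam B, Metric.diam_nonneg⟩ B hBne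
    (Metric.isBounded_ball.subset hB) rfl (by
      refine (Metric.le_infDist hBne).2 fun y hy => ?_
      have h1 : (μ ⟨Metric.diam B, Metric.diam_nonneg⟩ : ℝ) ≤ μ (2 * r).toNNReal :=
        NNReal.coe_le_coe.2 (hμ (NNReal.le_toNNReal_of_coe_le (hdiam hBne hB)))
      have h2 : dist y a < r := hB hy
      have h3 := dist_triangle_left a b y
      rw [dist_comm b y]
      linarith)
  refine ⟨C, hBC, fun a' r' hB' z hz => ?_⟩
  obtain ⟨y, hy⟩ := hBne
  have h1 : (ρ ⟨Metric.diam B, Metric.diam_nonneg⟩ : ℝ) ≤ ρ (2 * r').toNNReal :=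
    NNReal.coe_le_coe.2 (hρ (NNReal.le_toNNReal_of_coe_le (hdiam ⟨y, hy⟩ hB')))
  have h2 : dist y a' < r' := hB' hy
  have h3 := Metric.dist_le_diam_of_mem hCb hz (hBC.choose hy)
  have h4 := dist_triangle z y a'
  rw [Metric.mem_ball]
  linarith

/-- The points at distance less than `R x` from each entry `x` of the list. -/
def ballInter (R : X → ℝ) (s : List X) : Set X := {y | ∀ x ∈ s, y ∈ Metric.ball x (R x)}

/-- The family `E` satisfies the descent equation at `t` on `W`. -/
def DescendsOn (E : List X → List X → A) (t : List X) (W : Set X) : Prop :=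
  LocallyZeroOn W (E t) ∧ ∀ l : List X, (∀ x ∈ l, x ∈ W) →
    listD (E t) l = (-1 : ℤ) ^ t.length • listD (fun t' => E t' l) t

theorem DescendsOn.mono {E : List X → List X → A} {t : List X} {V W : Set X}
    (h : DescendsOn E t W) (hV : V ⊆ W) : DescendsOn E t V :=
  ⟨h.1.mono hV, fun l hl => h.2 l fun x hx => hV (hl x hx)⟩

theorem DescendsOn.congr {E F : List X → List X → A} {t : List X} {W : Set X}
    (h : DescendsOn E t W) (hE : ∀ t', t'.length ≤ t.length → F t' = E t') :
    DescendsOn F t W := by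
  refine ⟨(hE t le_rfl).symm ▸ h.1, fun l hl => ?_⟩
  rw [hE t le_rfl, h.2 l hl]
  congr 1
  exact listD_congr fun t' _ ht' => by rw [hE t' (by omega)]

/-- The right side is locally zero because `t` has finitely many sublists. It is a cocycle because
its coboundary commutes with deletion in `t`, and the descent equations one level down turn the
result into a double deletion. -/
theorem exists_listD_of_descendsOn {E : List X → List X → A} {t : List X} {B C : Set X}
    (hBC : B.Nonempty → ContractibleInside B C) (hE0 : ∀ t, E t [] = 0)
    (hE : ∀ t', t'.Sublist t → t'.length + 1 = t.length → DescendsOn E t' C) :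
    ∃ η : List X → A, η [] = 0 ∧ LocallyZeroOn B η ∧ ∀ l : List X, (∀ x ∈ l, x ∈ B) →
      listD η l = (-1 : ℤ) ^ t.length • listD (fun t' => E t' l) t := by
  rcases B.eq_empty_or_nonempty with rfl | hB
  · refine ⟨fun _ => 0, rfl, fun x hx => hx.elim, fun l hl => ?_⟩
    obtain rfl : l = [] := List.eq_nil_iff_forall_not_mem.2 hl
    simp [hE0]
  have hC : ContractibleInside B C := hBC hB
  obtain ⟨η, h1, h2⟩ := exists_listD_of_contractibleInside hC hB
    (ψ := fun l => (-1 : ℤ) ^ t.length • listD (fun t' => E t' l) t) (fun x hx => by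
      have hfin : {t' : List X | t'.Sublist t}.Finite := by
        refine (List.finite_toSet t.sublists).subset fun t' ht' => ?_
        exact List.mem_sublists.2 ht'
      have : ∀ᶠ U in (𝓝[C] x).smallSets, ∀ t' ∈ {t' : List X | t'.Sublist t},
          t'.length + 1 = t.length → ∀ l : List X, (∀ y ∈ l, y ∈ U) → E t' l = 0 := by
        refine (eventually_all_finite hfin).2 fun t' ht' => ?_
        by_cases hl : t'.length + 1 = t.length
        · filter_upwards [(hE t' ht' hl).1 x hx] with U hU _ using hU
        · exact Eventually.of_forall fun U h => (hl h).elim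
      filter_upwards [this] with U hU l hl
      rw [listD_congr (g := fun _ => 0) fun t' ht' h => hU t' ht' h l hl]
      simp) (fun l hl => by
      rw [listD_zsmul, ← listD_comm]
      rw [listD_congr fun t' ht' h => (hE t' ht' h).2 l hl]
      rw [listD_congr (g := fun t' => (-1 : ℤ) ^ (t.length - 1) • listD (fun t'' => E t'' l) t')
        fun t' ht' h => by rw [← h, Nat.add_sub_cancel]]
      rw [listD_zsmul, listD_listD, smul_zero, smul_zero])
  exact ⟨η, h1.nil hB, h1, h2⟩

/-- A family of radii at every point, decreasing in the index `q ≤ m` at the rate prescribed by the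
contractibility, and tending to infinity. -/
theorem exists_radii [Nonempty X] (hc : UniformlyContractibleAtInfinity X) (m : ℕ)
    {φ : List X → A} (hφ : LocallyZeroAtInfinity φ) (hd : CoarselyZero (listD φ)) :
    ∃ R : ℕ → X → ℝ,
      (∀ q < m, ∀ t : List X, t ≠ [] → (ballInter (R (q + 1)) t).Nonempty →
        ∃ C ⊆ ballInter (R q) t, ContractibleInside (ballInter (R (q + 1)) t) C) ∧
      (∀ a, LocallyZeroOn (Metric.ball a (R 0 a)) φ) ∧
      (∀ a, ∀ l : List X, (∀ x ∈ l, x ∈ Metric.ball a (R 0 a)) → listD φ l = 0) ∧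
      ∀ r : ℝ, ∀ᶠ a in cobounded X, ∀ q, r ≤ R q a := by
  classical
  obtain ⟨ρ, hρ, hcon⟩ := hc.exists_contractibleInside
  obtain ⟨κ, hκ, hQ⟩ := exists_scale (X := X) (Q := fun k a =>
    (∀ q ∈ Finset.range (m + 1), ∀ B : Set X, B.Nonempty → B ⊆ Metric.ball a (ρ^[m - q] k) →
      ∃ C, ContractibleInside B C ∧ ∀ a' r', B ⊆ Metric.ball a' r' → C ⊆ Metric.ball a' (ρ r')) ∧
    LocallyZeroOn (Metric.ball a (ρ^[m - 0] k)) φ ∧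
    ∀ l : List X, (∀ x ∈ l, x ∈ Metric.ball a (ρ^[m - 0] k)) → listD φ l = 0) (fun k => by
      refine ((Finset.eventually_all _).2 fun q _ => hcon _).and (Eventually.and ?_ (hd _))
      filter_upwards [eventually_forall_ball hφ (ρ^[m - 0] k)] with a ha x hx
      exact (ha x hx).filter_mono (monotone_smallSets nhdsWithin_le_nhds))
  have hit : ∀ (j : ℕ) (x : ℝ), x ≤ ρ^[j] x := fun j x => by
    induction j with
    | zero => rfl
    | succ j ih =>
      rw [Function.iterate_succ_apply']
      exact ih.trans (hρ _)
  -- Radius `0` gives an empty ball, so all conditions at a point with `κ a = 0` hold vacuously.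
  -- Elsewhere each decrease of `q` applies `ρ` once more.
  refine ⟨fun q a => if κ a = 0 then 0 else ρ^[m - q] (κ a : ℝ), fun q hq t ht hne => ?_,
    fun a => ?_, fun a => ?_, fun r => ?_⟩
  · obtain ⟨y, hy⟩ := hne
    have hpos : ∀ x ∈ t, κ x ≠ 0 := fun x hx h0 => by
      have := hy x hx
      simp [h0] at this
    obtain ⟨a, ha⟩ := List.exists_mem_of_ne_nil t ht
    obtain ⟨C, hBC, hC⟩ := (hQ a (hpos a ha)).1 (q + 1) (by simpa using hq) _ ⟨y, hy⟩
      (fun z hz => by simpa [hpos a ha] using hz a ha)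
    refine ⟨C, fun z hz x hx => ?_, hBC⟩
    have := hC x (ρ^[m - (q + 1)] (κ x)) (fun z hz => by simpa [hpos x hx] using hz x hx) hz
    rw [← Function.iterate_succ_apply' ρ, show (m - (q + 1)).succ = m - q by omega] at this
    simpa [hpos x hx] using this
  · by_cases h0 : κ a = 0
    · intro x hx
      simp [h0] at hx
    · simpa [h0] using (hQ a h0).2.1
  · by_cases h0 : κ a = 0
    · intro l hl
      obtain rfl : l = [] := List.eq_nil_iff_forall_not_mem.2 fun x hx => by
        simpa [h0] using hl x hx
      rfl
    · simpa [h0] using (hQ a h0).2.2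
  · filter_upwards [(tendsto_natCast_atTop_atTop.comp hκ).eventually
      (eventually_ge_atTop r)] with a ha q
    refine le_trans ha ?_
    by_cases h0 : κ a = 0
    · simp [h0]
    · simpa [h0] using hit (m - q) (κ a)

/-- Induction on the length of `t`. The auxiliary nonempty `s ⊇ t` is there for `t = []`, whose
`ballInter` is all of `X`, where `φ` is not controlled. -/
theorem exists_descent {m : ℕ} {φ : List X → A} (h0 : φ [] = 0) {R : ℕ → X → ℝ}
    (hR : ∀ q < m, ∀ t : List X, t ≠ [] → (ballInter (R (q + 1)) t).Nonempty →
      ∃ C ⊆ ballInter (R q) t, ContractibleInside (ballInter (R (q + 1)) t) C)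
    (hφ : ∀ a, LocallyZeroOn (Metric.ball a (R 0 a)) φ)
    (hd : ∀ a, ∀ l : List X, (∀ x ∈ l, x ∈ Metric.ball a (R 0 a)) → listD φ l = 0) :
    ∃ E : List X → List X → A, E [] = φ ∧ (∀ t, E t [] = 0) ∧
      ∀ t, t.length ≤ m → ∀ s, s ≠ [] → t ⊆ s → DescendsOn E t (ballInter (R t.length) s) := by
  classical
  suffices ∀ q ≤ m, ∃ E : List X → List X → A, E [] = φ ∧ (∀ t, E t [] = 0) ∧
      ∀ t, t.length ≤ q → ∀ s, s ≠ [] → t ⊆ s → DescendsOn E t (ballInter (R t.length) s) from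
    this m le_rfl
  intro q
  induction q with
  | zero =>
    refine fun _ => ⟨fun t => if t = [] then φ else fun _ => 0, if_pos rfl, fun t => ?_,
      fun t ht s hs _ => ?_⟩
    · dsimp only
      split_ifs
      exacts [h0, rfl]
    · obtain rfl : t = [] := List.eq_nil_of_length_eq_zero (by omega)
      obtain ⟨a, ha⟩ := List.exists_mem_of_ne_nil s hs
      have hsub : ballInter (R 0) s ⊆ Metric.ball a (R 0 a) := fun y hy => hy a ha
      refine ⟨by simpa using (hφ a).mono hsub, fun l hl => ?_⟩
      simpa using hd a l fun x hx => hsub (hl x hx)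
  | succ q ih =>
    intro hq
    obtain ⟨E, hE, hE0, hEd⟩ := ih (by omega)
    have hex : ∀ t : List X, ∃ η : List X → A, η [] = 0 ∧ (t.length = q + 1 →
        LocallyZeroOn (ballInter (R (q + 1)) t) η ∧
        ∀ l : List X, (∀ x ∈ l, x ∈ ballInter (R (q + 1)) t) →
          listD η l = (-1 : ℤ) ^ t.length • listD (fun t' => E t' l) t) := fun t => by
      by_cases ht : t.length = q + 1
      · have htne : t ≠ [] := by rintro rfl; simp at ht
        have : ∃ C ⊆ ballInter (R q) t, (ballInter (R (q + 1)) t).Nonempty →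
            ContractibleInside (ballInter (R (q + 1)) t) C := by
          by_cases hne : (ballInter (R (q + 1)) t).Nonempty
          · obtain ⟨C, hC, hC'⟩ := hR q (by omega) t htne hne
            exact ⟨C, hC, fun _ => hC'⟩
          · exact ⟨∅, Set.empty_subset _, fun h => (hne h).elim⟩
        obtain ⟨C, hC, hBC⟩ := this
        obtain ⟨η, h1, h2⟩ := exists_listD_of_descendsOn (t := t) hBC hE0 fun t' ht' hl => by
          have hl' : t'.length = q := by omega
          refine (hEd t' (by omega) t htne ht'.subset).mono ?_
          rwa [hl']
        exact ⟨η, h1, fun _ => h2⟩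
      · exact ⟨fun _ => 0, rfl, fun h => (ht h).elim⟩
    choose η hη0 hη using hex
    refine ⟨fun t => if t.length = q + 1 then η t else E t, ?_, fun t => ?_, fun t ht s hs hts => ?_⟩
    · simpa using hE
    · dsimp only
      split_ifs
      exacts [hη0 t, hE0 t]
    · rcases Nat.lt_or_ge t.length (q + 1) with hlt | hge
      · exact (hEd t (by omega) s hs hts).congr fun t' ht' => if_neg (by omega)
      · have ht' : t.length = q + 1 := le_antisymm ht hge
        have hsub : ballInter (R (q + 1)) s ⊆ ballInter (R (q + 1)) t :=
          fun y hy x hx => hy x (hts hx)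
        rw [ht']
        refine ⟨?_, fun l hl => ?_⟩
        · simpa [ht'] using (hη t ht').1.mono hsub
        · have h1 := (hη t ht').2 l fun x hx => hsub (hl x hx)
          simp only [ht', if_true]
          rw [h1, ht']
          congr 1
          refine listD_congr fun t' _ hl' => ?_
          rw [if_neg (by omega)]

theorem exists_listD_coarselyZero [Nonempty X] (hc : UniformlyContractibleAtInfinity X) (m : ℕ)
    {φ : List X → A} (h0 : φ [] = 0) (hφ : LocallyZeroAtInfinity φ)
    (hd : CoarselyZero (listD φ)) :
    ∃ η : List X → A, LocallyZeroAtInfinity (fun l => if l.length ≤ m then η l else 0) ∧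
      CoarselyZero (fun l => if l.length ≤ m then φ l - listD η l else 0) := by
  classical
  obtain ⟨R, hR, hRφ, hRd, hRlim⟩ := exists_radii hc m hφ hd
  obtain ⟨E, hE, hE0, hEd⟩ := exists_descent h0 hR hRφ hRd
  obtain ⟨p, hp, hpfin⟩ := exists_approximation_locally_finite_range X
  refine ⟨fun l => -overlapSum (fun t l => E (t.map p) l) l, ?_, fun r => ?_⟩
  -- Points within `1` of `x` are rounded by `p` to within `2` of `x`. Hence radius `3` keeps them
  -- inside every ball that occurs.
  · filter_upwards [eventually_forall_ball (hRlim 3) 2] with x hx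
    obtain ⟨U₀, hU₀, hfin⟩ := hpfin x
    let U := U₀ ∩ Metric.ball x 1
    have hU : U ∈ 𝓝 x := inter_mem hU₀ (Metric.ball_mem_nhds x one_pos)
    have hF : (p '' U).Finite := hfin.subset (Set.image_mono Set.inter_subset_left)
    have hFx : ∀ y ∈ p '' U, dist y x < 2 := by
      rintro _ ⟨z, hz, rfl⟩
      have h1 := hp z
      have h2 : dist z x < 1 := hz.2
      linarith [dist_triangle (p z) z x]
    have hT : {t : List X | t.length ≤ m ∧ ∀ y ∈ t, y ∈ p '' U}.Finite := by
      have := hF.to_subtype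
      refine ((List.finite_length_le (p '' U) m).image (List.map (↑))).subset ?_
      rintro t ⟨ht, htF⟩
      lift t to List (p '' U) using htF
      exact ⟨t, by simpa using ht, rfl⟩
    have key : ∀ᶠ V in (𝓝 x).smallSets,
        ∀ t ∈ {t : List X | t.length ≤ m ∧ ∀ y ∈ t, y ∈ p '' U}, t ≠ [] →
          ∀ l : List X, (∀ y ∈ l, y ∈ V) → E t l = 0 := by
      refine (eventually_all_finite hT).2 fun t ht => ?_
      by_cases hne : t = []
      · exact Eventually.of_forall fun _ h => (h hne).elim
      have hW : ballInter (R t.length) t ∈ 𝓝 x := by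
        filter_upwards [Metric.ball_mem_nhds x one_pos] with y hy a ha
        have h1 := hFx a (ht.2 a ha)
        have h2 := hx a h1 t.length
        have h3 : dist y x < 1 := hy
        rw [Metric.mem_ball]
        linarith [dist_triangle_right y a x]
      have h := (hEd t ht.1 t hne (List.Subset.refl t)).1 x (mem_of_mem_nhds hW)
      rw [nhdsWithin_eq_nhds.2 hW] at h
      filter_upwards [h] with V hV _ using hV
    filter_upwards [key, eventually_smallSets.2 ⟨U, hU, fun V hV => hV⟩] with V hV hVU l hl
    split_ifs with hm
    · rw [overlapSum_eq_zero, neg_zero]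
      rintro t a l' rfl
      refine hV _ ⟨?_, ?_⟩ (by simp) _ fun y hy => hl y (List.mem_append_right _ hy)
      · simp only [List.length_append, List.length_cons, List.length_map] at hm ⊢
        simp
        omega
      · intro y hy
        obtain ⟨z, hz, rfl⟩ := List.mem_map.1 hy
        refine ⟨z, hVU (hl z ?_), rfl⟩
        simp only [List.mem_append, List.mem_cons, List.not_mem_nil, or_false] at hz ⊢
        tauto
    · rfl
  -- Two entries of `l` are less than `2 * r` apart and rounding by `p` costs less than `1`. The
  -- descent equation cancels the mixed terms, and `E t [] = 0` removes the far boundary term.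
  · filter_upwards [eventually_forall_ball (hRlim (2 * r + 1)) (r + 1)] with a ha l hl
    split_ifs with hm
    · rw [listD_neg, listD_overlapSum, overlapSum_eq_zero]
      · simp [hE, hE0]
      rintro t x l' rfl
      rw [listD_map p fun t' => E t' (x :: l')]
      have hlen : ((t ++ [x]).map p).length ≤ m := by
        simp only [List.length_append, List.length_cons, List.length_map] at hm ⊢
        simp
        omega
      rw [(hEd _ hlen _ (by simp) (List.Subset.refl _)).2 (x :: l'), List.length_map, smul_smul,
        ← mul_pow]
      · simp
      intro y hy z hz
      obtain ⟨w, hw, rfl⟩ := List.mem_map.1 hz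
      have hw' : w ∈ t ++ x :: l' := by
        simp only [List.mem_append, List.mem_cons, List.not_mem_nil, or_false] at hw ⊢
        tauto
      have h1 : dist y a < r := hl y (List.mem_append_right _ hy)
      have h2 : dist w a < r := hl w hw'
      have h3 := hp w
      have h4 := ha (p w) (by
        rw [Metric.mem_ball]
        linarith [dist_triangle (p w) w a]) ((t ++ [x]).map p).length
      rw [Metric.mem_ball]
      linarith [dist_triangle4_right y (p w) a w, dist_triangle_right y w a,
        dist_triangle y w (p w), dist_comm w (p w)]
    · rfl

end Glue

end CoarseCohomology

namespace CoarseCohomology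

open Filter Topology Bornology

universe u v

/-! ### Cochains that are locally zero at infinity -/

section Cochains

variable {R : Type v} [Ring R] {X : Type u}

open Classical in
/-- A cochain as a function on lists, zero on lists of the wrong length. -/
noncomputable def listExtend {n : ℕ} (φ : Cochain R X n) : List X → R := fun l =>
  if h : ∃ σ : Fin (n + 1) → X, List.ofFn σ = l then φ h.choose else 0

theorem listExtend_ofFn {n : ℕ} (φ : Cochain R X n) (σ : Fin (n + 1) → X) :
    listExtend φ (List.ofFn σ) = φ σ := by
  have h : ∃ τ : Fin (n + 1) → X, List.ofFn τ = List.ofFn σ := ⟨σ, rfl⟩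
  rw [listExtend, dif_pos h, List.ofFn_injective h.choose_spec]

theorem listExtend_of_length_ne {n : ℕ} (φ : Cochain R X n) {l : List X} (h : l.length ≠ n + 1) :
    listExtend φ l = 0 := by
  refine dif_neg ?_
  rintro ⟨σ, rfl⟩
  simp at h

theorem exists_ofFn_eq {n : ℕ} {l : List X} (h : l.length = n) :
    ∃ σ : Fin n → X, List.ofFn σ = l := by
  subst h
  exact ⟨l.get, List.ofFn_get l⟩

theorem listD_ofFn_eq_coboundary {n : ℕ} (f : List X → R) (σ : Fin (n + 2) → X) :
    listD f (List.ofFn σ) =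
      coboundary R X n (fun τ : Fin (n + 1) → X => f (List.ofFn τ)) σ :=
  listD_ofFn f σ

theorem listD_listExtend_ofFn {n : ℕ} (φ : Cochain R X n) (σ : Fin (n + 2) → X) :
    listD (listExtend φ) (List.ofFn σ) = coboundary R X n φ σ := by
  rw [listD_ofFn_eq_coboundary]
  simp only [listExtend_ofFn]

variable (R X) in
/-- Coboundaries of the augmented complex of all cochains. -/
def augmentedBoundaries : (n : ℕ) → Submodule R (Cochain R X n)
  | 0 => LinearMap.range (LinearMap.pi fun _ => LinearMap.id : R →ₗ[R] ((Fin 1 → X) → R))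
  | n + 1 => LinearMap.range (coboundary R X n)

/-- Evaluating `d φ = 0` on simplices with first vertex `b` exhibits `φ` as the coboundary of its
cone. -/
theorem coboundary_eq_zero_iff [Nonempty X] {n : ℕ} {φ : Cochain R X n} :
    coboundary R X n φ = 0 ↔ φ ∈ augmentedBoundaries R X n := by
  constructor
  · intro h
    obtain ⟨b⟩ := ‹Nonempty X›
    have key : ∀ σ : Fin (n + 1) → X,
        φ σ = listD (fun l => listExtend φ (b :: l)) (List.ofFn σ) := fun σ => by
      have h1 := listD_listExtend_ofFn φ (Fin.cons b σ : Fin (n + 2) → X)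
      rw [h, List.ofFn_cons, listD_cons, listExtend_ofFn] at h1
      exact sub_eq_zero.1 h1
    cases n with
    | zero =>
      refine ⟨listExtend φ [b], ?_⟩
      funext σ
      rw [key σ]
      simp [listD_cons]
      rfl
    | succ n =>
      refine ⟨fun τ => listExtend φ (b :: List.ofFn τ), ?_⟩
      funext σ
      rw [key σ, listD_ofFn_eq_coboundary]
  · intro h
    cases n with
    | zero =>
      obtain ⟨c, rfl⟩ := h
      funext σ
      change ∑ i : Fin 2, (-1 : ℤ) ^ (i : ℕ) • c = 0
      simp
    | succ n =>
      obtain ⟨ψ, rfl⟩ := h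
      exact coboundary_coboundary ψ

end Cochains

/-! ### Coarse cochains compared with cochains locally zero at infinity -/

section Infinity

variable {R : Type v} [Ring R] {X : Type u}

theorem mem_locallyZero_iff [TopologicalSpace X] {n : ℕ} {φ : Cochain R X n} :
    φ ∈ locallyZero R X n ↔
      ∀ x, ∃ U ∈ 𝓝 x, ∀ σ : Fin (n + 1) → X, (∀ i, σ i ∈ U) → φ σ = 0 := by
  have h : φ ∈ locallyZero R X n ↔ ∀ x : X, (fun _ => x) ∉ closure (Function.support φ) := by
    change diagonal X n ∩ closure (Function.support φ) = ∅ ↔ _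
    rw [← Set.disjoint_iff_inter_eq_empty, Set.disjoint_left, diagonal, Set.forall_mem_range]
  rw [h]
  refine forall_congr' fun x => ?_
  rw [mem_closure_iff_frequently, not_frequently, nhds_pi]
  constructor
  · intro h
    obtain ⟨I, -, t, ht, hsub⟩ := Filter.mem_pi.1 h
    refine ⟨⋂ i, t i, iInter_mem.2 ht, fun σ hσ => ?_⟩
    exact Function.notMem_support.1 (hsub fun i _ => Set.mem_iInter.1 (hσ i) i)
  · rintro ⟨U, hU, h⟩
    refine Filter.mem_pi.2 ⟨Set.univ, Set.finite_univ, fun _ => U, fun _ => hU, fun σ hσ => ?_⟩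
    exact Function.notMem_support.2 (h σ fun i => hσ i trivial)

variable [MetricSpace X]

/-- A simplex lies in the `r`-thickening of the diagonal exactly when its vertices lie in a common
ball of radius `r`. -/
theorem mem_coarseCochain_iff {n : ℕ} {φ : Cochain R X n} :
    φ ∈ coarseCochain R X n ↔ ∀ r : ℝ, ∀ᶠ a in cobounded X, ∀ σ : Fin (n + 1) → X,
      (∀ i, σ i ∈ Metric.ball a r) → φ σ = 0 := by
  rcases isEmpty_or_nonempty X with hX | ⟨⟨b⟩⟩
  · exact ⟨fun _ r => Eventually.of_forall fun a => (hX.false a).elim,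
      fun _ r => (Set.toFinite _).isBounded⟩
  change (∀ r : ℝ, IsBounded (Function.support φ ∩ Metric.thickening r (diagonal X n))) ↔ _
  refine forall_congr' fun r => ⟨fun h => ?_, fun h => ?_⟩
  · obtain ⟨M, hM⟩ := h.subset_ball (fun _ => b)
    filter_upwards [(Metric.tendsto_dist_right_cobounded_atTop b).eventually
      (eventually_ge_atTop (M + r))] with a ha σ hσ
    by_contra hne
    have hr : 0 < r := dist_nonneg.trans_lt (hσ 0)
    have h1 : dist σ (fun _ => b) < M := hM ⟨hne, Metric.mem_thickening_iff.2
      ⟨fun _ => a, ⟨a, rfl⟩, (dist_pi_lt_iff hr).2 hσ⟩⟩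
    have h2 : dist (σ 0) b < M := (dist_le_pi_dist σ (fun _ => b) 0).trans_lt h1
    have h3 : dist (σ 0) a < r := hσ 0
    linarith [dist_triangle_left a b (σ 0)]
  · have h' : IsBounded {a | ∀ σ : Fin (n + 1) → X, (∀ i, σ i ∈ Metric.ball a r) → φ σ = 0}ᶜ :=
      isBounded_def.2 (by rwa [compl_compl])
    obtain ⟨M, hM⟩ := h'.subset_ball b
    refine (Metric.isBounded_closedBall (x := fun _ : Fin (n + 1) => b) (r := r + M)).subset ?_
    rintro σ ⟨hσ, hσr⟩
    obtain ⟨_, ⟨a, rfl⟩, ha⟩ := Metric.mem_thickening_iff.1 hσr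
    have hr : 0 < r := dist_nonneg.trans_lt ha
    have h1 : dist a b < M := hM fun h => hσ (h σ fun i => (dist_pi_lt_iff hr).1 ha i)
    have h2 : dist (fun _ : Fin (n + 1) => a) (fun _ => b) ≤ dist a b :=
      (dist_pi_le_iff dist_nonneg).2 fun _ => le_rfl
    rw [Metric.mem_closedBall]
    linarith [dist_triangle σ (fun _ => a) (fun _ => b)]

variable (R X) in
/-- Cochains that vanish on a neighbourhood of the diagonal outside a bounded set. -/
def zeroAtInfinity (n : ℕ) : Submodule R (Cochain R X n) where
  carrier := {φ | ∀ᶠ x in cobounded X, ∀ᶠ U in (𝓝 x).smallSets,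
    ∀ σ : Fin (n + 1) → X, (∀ i, σ i ∈ U) → φ σ = 0}
  zero_mem' := Eventually.of_forall fun _ => Eventually.of_forall fun _ _ _ => rfl
  add_mem' {φ ψ} hφ hψ := by
    filter_upwards [hφ, hψ] with x h1 h2
    filter_upwards [h1, h2] with U h3 h4 σ hσ
    change φ σ + ψ σ = 0
    rw [h3 σ hσ, h4 σ hσ, add_zero]
  smul_mem' c φ hφ := by
    filter_upwards [hφ] with x h1
    filter_upwards [h1] with U h2 σ hσ
    change c * φ σ = 0
    rw [h2 σ hσ, mul_zero]

theorem coarseCochain_le_zeroAtInfinity (n : ℕ) :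
    coarseCochain R X n ≤ zeroAtInfinity R X n := fun φ hφ => by
  filter_upwards [mem_coarseCochain_iff.1 hφ 1] with x hx
  refine eventually_smallSets.2 ⟨_, Metric.ball_mem_nhds x one_pos, fun U hU σ hσ => ?_⟩
  exact hx σ fun i => hU (hσ i)

/-- In degree `0` the diagonal is everything, so vanishing near it at infinity means having bounded
support. -/
theorem zeroAtInfinity_zero_le : zeroAtInfinity R X 0 ≤ coarseCochain R X 0 := fun φ hφ =>
  mem_coarseCochain_iff.2 fun r => by
    filter_upwards [eventually_forall_ball hφ r] with a ha σ hσ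
    obtain ⟨U, hU, h⟩ := eventually_smallSets.1 (ha (σ 0) (hσ 0))
    refine h U subset_rfl σ fun i => ?_
    rw [show i = 0 from Fin.fin_one_eq_zero i]
    exact mem_of_mem_nhds hU

theorem exists_sub_coboundary_mem_coarseCochain [Nonempty X]
    (hc : UniformlyContractibleAtInfinity X) {n : ℕ} {φ : Cochain R X (n + 1)}
    (hφ : φ ∈ zeroAtInfinity R X (n + 1))
    (hd : coboundary R X (n + 1) φ ∈ coarseCochain R X (n + 2)) :
    ∃ η ∈ zeroAtInfinity R X n, φ - coboundary R X n η ∈ coarseCochain R X (n + 1) := by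
  -- Simplices of degree `n + 1`, where `φ` lives, are lists of length `n + 2`.
  obtain ⟨η, h1, h2⟩ := exists_listD_coarselyZero hc (n + 2) (φ := listExtend φ)
    (listExtend_of_length_ne φ (by simp)) (by
      filter_upwards [hφ] with x h1
      filter_upwards [h1] with U h2 l hl
      by_cases h : l.length = n + 1 + 1
      · obtain ⟨σ, rfl⟩ := exists_ofFn_eq h
        rw [listExtend_ofFn]
        exact h2 σ fun i => hl _ (List.mem_ofFn.2 ⟨i, rfl⟩)
      · exact listExtend_of_length_ne φ h) (fun r => by
      filter_upwards [mem_coarseCochain_iff.1 hd r] with a ha l hl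
      by_cases h : l.length = n + 1 + 2
      · obtain ⟨σ, rfl⟩ := exists_ofFn_eq h
        rw [listD_listExtend_ofFn]
        exact ha σ fun i => hl _ (List.mem_ofFn.2 ⟨i, rfl⟩)
      · rw [listD_congr (g := fun _ => 0), listD_zero]
        exact fun t _ ht => listExtend_of_length_ne φ (by omega))
  refine ⟨fun σ => η (List.ofFn σ), ?_, mem_coarseCochain_iff.2 fun r => ?_⟩
  · filter_upwards [h1] with x h3
    filter_upwards [h3] with U h4 σ hσ
    have := h4 (List.ofFn σ) ((List.forall_mem_ofFn_iff).2 hσ)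
    rwa [if_pos (by simp)] at this
  · filter_upwards [h2 r] with a h3 σ hσ
    have := h3 (List.ofFn σ) ((List.forall_mem_ofFn_iff).2 hσ)
    rwa [if_pos (by simp), listExtend_ofFn, listD_ofFn_eq_coboundary] at this

end Infinity

/-! ### Comparison with the direct limit -/

section Comparison

variable (R : Type v) [Ring R] {X : Type u}

/-- Restriction of cochains to a subset. -/
def restrictTo (Y : Set X) (n : ℕ) : Cochain R X n →ₗ[R] Cochain R Y n :=
  pullback R (fun y : Y => (y : X)) n

open Classical in
/-- Extension of cochains by zero. -/
noncomputable def extendByZero (Y : Set X) (n : ℕ) : Cochain R Y n →ₗ[R] Cochain R X n where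
  toFun φ := fun σ => if h : ∀ i, σ i ∈ Y then φ fun i => ⟨σ i, h i⟩ else 0
  map_add' φ ψ := by
    funext σ
    change (if h : ∀ i, σ i ∈ Y then (φ fun i => ⟨σ i, h i⟩) + ψ fun i => ⟨σ i, h i⟩ else 0) =
      (if h : ∀ i, σ i ∈ Y then φ fun i => ⟨σ i, h i⟩ else 0) +
        if h : ∀ i, σ i ∈ Y then ψ fun i => ⟨σ i, h i⟩ else 0
    split_ifs
    exacts [rfl, (add_zero 0).symm]
  map_smul' c φ := by
    funext σ
    change (if h : ∀ i, σ i ∈ Y then c * φ fun i => ⟨σ i, h i⟩ else 0) =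
      c * if h : ∀ i, σ i ∈ Y then φ fun i => ⟨σ i, h i⟩ else 0
    split_ifs
    exacts [rfl, (mul_zero c).symm]

variable {R}

theorem restrictTo_extendByZero (Y : Set X) {n : ℕ} (φ : Cochain R Y n) :
    restrictTo R Y n (extendByZero R Y n φ) = φ := by
  funext σ
  exact dif_pos fun i => (σ i).2

theorem restrictTo_coboundary (Y : Set X) {n : ℕ} (φ : Cochain R X n) :
    restrictTo R Y (n + 1) (coboundary R X n φ) = coboundary R Y n (restrictTo R Y n φ) := rfl

theorem restrictTo_mem_augmentedBoundaries (Y : Set X) {n : ℕ} {φ : Cochain R X n}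
    (h : φ ∈ augmentedBoundaries R X n) : restrictTo R Y n φ ∈ augmentedBoundaries R Y n := by
  cases n with
  | zero =>
    obtain ⟨c, rfl⟩ := h
    exact ⟨c, rfl⟩
  | succ n =>
    obtain ⟨ψ, rfl⟩ := h
    exact ⟨restrictTo R Y n ψ, rfl⟩

theorem exists_restrictTo_eq_of_mem_augmentedBoundaries (Y : Set X) {n : ℕ} {φ : Cochain R Y n}
    (h : φ ∈ augmentedBoundaries R Y n) :
    ∃ ψ ∈ augmentedBoundaries R X n, restrictTo R Y n ψ = φ := by
  cases n with
  | zero =>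
    obtain ⟨c, rfl⟩ := h
    exact ⟨_, ⟨c, rfl⟩, rfl⟩
  | succ n =>
    obtain ⟨ψ, rfl⟩ := h
    refine ⟨_, ⟨extendByZero R Y n ψ, rfl⟩, ?_⟩
    rw [restrictTo_coboundary, restrictTo_extendByZero]

variable [MetricSpace X]

theorem mem_zeroAtInfinity_of_restrictTo {b : X} {r : ℝ≥0} {n : ℕ} {φ : Cochain R X n}
    (h : restrictTo R (Metric.ball b r)ᶜ n φ ∈ locallyZero R _ n) :
    φ ∈ zeroAtInfinity R X n := by
  filter_upwards [(Metric.tendsto_dist_right_cobounded_atTop b).eventually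
    (eventually_gt_atTop (r : ℝ))] with x hx
  -- The complement of an open ball is not open. The strict inequality `r < dist x b` places `x` in
  -- the open complement of the closed ball.
  have hmem : (Metric.ball b r)ᶜ ∈ 𝓝 x :=
    mem_of_superset (Metric.isClosed_closedBall.isOpen_compl.mem_nhds
      (x := x) (s := (Metric.closedBall b r)ᶜ) fun h => hx.not_ge h)
      (Set.compl_subset_compl.2 Metric.ball_subset_closedBall)
  obtain ⟨U, hU, h0⟩ := mem_locallyZero_iff.1 h ⟨x, mem_of_mem_nhds hmem⟩
  obtain ⟨V, hV, hVU⟩ := (mem_nhds_subtype _ _ _).1 hU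
  refine eventually_smallSets.2 ⟨_, inter_mem hV hmem, fun W hW σ hσ => ?_⟩
  exact h0 (fun i => ⟨σ i, (hW (hσ i)).2⟩) fun i => hVU (hW (hσ i)).1

theorem sub_mem_zeroAtInfinity {b : X} (r : ℝ≥0) {n : ℕ} {φ ψ : Cochain R X n}
    (h : restrictTo R (Metric.ball b r)ᶜ n φ = restrictTo R (Metric.ball b r)ᶜ n ψ) :
    φ - ψ ∈ zeroAtInfinity R X n := by
  refine mem_zeroAtInfinity_of_restrictTo (b := b) (r := r) ?_
  rw [map_sub, h, sub_self]
  exact Submodule.zero_mem _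

theorem exists_restrictTo_mem_locallyZero (b : X) {n : ℕ} {φ : Cochain R X n}
    (hφ : φ ∈ zeroAtInfinity R X n) :
    ∃ r₀ : ℝ≥0, ∀ r ≥ r₀, restrictTo R (Metric.ball b (r : ℝ))ᶜ n φ ∈ locallyZero R _ n := by
  have h' : IsBounded {x | ∀ᶠ U in (𝓝 x).smallSets,
      ∀ σ : Fin (n + 1) → X, (∀ i, σ i ∈ U) → φ σ = 0}ᶜ :=
    isBounded_def.2 (by rw [compl_compl]; exact hφ)
  obtain ⟨M, hM⟩ := h'.subset_ball b
  refine ⟨M.toNNReal, fun r hr => mem_locallyZero_iff.2 fun x => ?_⟩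
  have hx : ∀ᶠ U in (𝓝 (x : X)).smallSets,
      ∀ σ : Fin (n + 1) → X, (∀ i, σ i ∈ U) → φ σ = 0 := by
    by_contra hne
    exact x.2 (Metric.ball_subset_ball (Real.toNNReal_le_iff_le_coe.1 hr) (hM hne))
  obtain ⟨U, hU, h⟩ := eventually_smallSets.1 hx
  exact ⟨_, preimage_coe_mem_nhds_subtype.2 (mem_nhdsWithin_of_mem_nhds hU),
    fun σ hσ => h U subset_rfl _ hσ⟩

variable (R X) in
/-- Cochains up to coboundaries and cochains that are locally zero at infinity. -/
abbrev CochainAtInfinity (n : ℕ) : Type (max u v) :=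
  Cochain R X n ⧸ (zeroAtInfinity R X n ⊔ augmentedBoundaries R X n)

theorem mk_eq_mk_of_restrictTo {b : X} (r : ℝ≥0) {n : ℕ} {φ ψ : Cochain R X n}
    (h : restrictTo R (Metric.ball b r)ᶜ n φ = restrictTo R (Metric.ball b r)ᶜ n ψ) :
    (Submodule.Quotient.mk φ : CochainAtInfinity R X n) = Submodule.Quotient.mk ψ :=
  (Submodule.Quotient.eq _).2 (Submodule.mem_sup_left (sub_mem_zeroAtInfinity r h))

theorem mem_asReducedBoundaries_iff {Y : Type u} [TopologicalSpace Y] {n : ℕ}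
    {a : ASCochain R Y n} : a ∈ asReducedBoundaries R Y n ↔
      ∃ φ ∈ augmentedBoundaries R Y n, Submodule.Quotient.mk φ = a := by
  cases n with
  | zero =>
    constructor
    · rintro ⟨c, rfl⟩
      exact ⟨_, ⟨c, rfl⟩, rfl⟩
    · rintro ⟨_, ⟨c, rfl⟩, rfl⟩
      exact ⟨c, rfl⟩
  | succ n =>
    constructor
    · rintro ⟨a, rfl⟩
      obtain ⟨φ, rfl⟩ := Submodule.Quotient.mk_surjective _ a
      exact ⟨_, ⟨φ, rfl⟩, rfl⟩
    · rintro ⟨_, ⟨φ, rfl⟩, rfl⟩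
      exact ⟨Submodule.Quotient.mk φ, rfl⟩

/-- Extension by zero on Alexander–Spanier cochains. -/
noncomputable def asExtend (b : X) (r : ℝ≥0) (n : ℕ) :
    ASCochain R ((Metric.ball b r)ᶜ : Set X) n →ₗ[R] CochainAtInfinity R X n :=
  Submodule.liftQ _ ((Submodule.mkQ _).comp (extendByZero R (Metric.ball b r)ᶜ n)) fun φ hφ => by
    refine (Submodule.Quotient.mk_eq_zero _).2 (Submodule.mem_sup_left ?_)
    refine mem_zeroAtInfinity_of_restrictTo (b := b) (r := r) ?_
    rwa [restrictTo_extendByZero]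

theorem asExtend_mk_restrictTo (b : X) (r : ℝ≥0) {n : ℕ} (φ : Cochain R X n) :
    asExtend b r n (Submodule.Quotient.mk (restrictTo R (Metric.ball b r)ᶜ n φ)) =
      Submodule.Quotient.mk φ :=
  mk_eq_mk_of_restrictTo r (restrictTo_extendByZero _ _)

/-- Extension by zero on reduced Alexander–Spanier cohomology. -/
noncomputable def reducedASExtend (b : X) (r : ℝ≥0) (n : ℕ) :
    ReducedAS R ((Metric.ball b r)ᶜ : Set X) n →ₗ[R] CochainAtInfinity R X n :=
  Submodule.liftQ _ ((asExtend b r n).comp (Submodule.subtype _)) fun a ha => by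
    obtain ⟨φ, hφ, h⟩ := mem_asReducedBoundaries_iff.1 (show a.1 ∈ asReducedBoundaries R _ n from ha)
    obtain ⟨ψ, hψ, rfl⟩ := exists_restrictTo_eq_of_mem_augmentedBoundaries _ hφ
    change asExtend b r n a.1 = 0
    rw [← h, asExtend_mk_restrictTo]
    exact (Submodule.Quotient.mk_eq_zero _).2 (Submodule.mem_sup_right hψ)

/-- Every class is represented by the restriction of a cochain on `X`. -/
theorem exists_reducedAS_rep {b : X} {r : ℝ≥0} {n : ℕ}
    (x : ReducedAS R ((Metric.ball b r)ᶜ : Set X) n) :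
    ∃ (φ : Cochain R X n) (h : Submodule.Quotient.mk (restrictTo R (Metric.ball b r)ᶜ n φ) ∈
      LinearMap.ker (asD R _ n)), Submodule.Quotient.mk ⟨_, h⟩ = x := by
  obtain ⟨⟨a, ha⟩, rfl⟩ := Submodule.Quotient.mk_surjective _ x
  obtain ⟨φ, rfl⟩ := Submodule.Quotient.mk_surjective _ a
  refine ⟨extendByZero R _ n φ, ?_, ?_⟩
  · rwa [restrictTo_extendByZero]
  · congr 2
    rw [restrictTo_extendByZero]

theorem reducedASExtend_reducedASMap (b : X) {r s : ℝ≥0} (h : r ≤ s) (n : ℕ)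
    (x : ReducedAS R ((Metric.ball b r)ᶜ : Set X) n) :
    reducedASExtend b s n (reducedASMap R (complInclusion b h) n x) = reducedASExtend b r n x := by
  obtain ⟨φ, hφ, rfl⟩ := exists_reducedAS_rep x
  exact (asExtend_mk_restrictTo b s φ).trans (asExtend_mk_restrictTo b r φ).symm

variable (R) in
/-- The map from the direct limit given by extension by zero. -/
noncomputable def atInfinityExtend (b : X) (n : ℕ) :
    ReducedASAtInfinity R b n →ₗ[R] CochainAtInfinity R X n :=
  Module.DirectLimit.lift R _ _ _ (fun r => reducedASExtend b r n)
    fun _ _ h x => reducedASExtend_reducedASMap b h n x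

/-- If a representative is `δ + β` with `δ` locally zero at infinity and `β` an augmented
coboundary, then passing to a larger radius makes `δ` locally zero, so the class dies in the limit.
-/
theorem atInfinityExtend_injective (b : X) (n : ℕ) :
    Function.Injective (atInfinityExtend R b n) := by
  rw [injective_iff_map_eq_zero]
  intro x hx
  obtain ⟨r, x, rfl⟩ := Module.DirectLimit.exists_of x
  rw [atInfinityExtend, Module.DirectLimit.lift_of] at hx
  obtain ⟨φ, hφ, rfl⟩ := exists_reducedAS_rep x
  have hx' := (Submodule.Quotient.mk_eq_zero _).1 ((asExtend_mk_restrictTo b r φ).symm.trans hx)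
  obtain ⟨δ, hδ, β, hβ, rfl⟩ := Submodule.mem_sup.1 hx'
  obtain ⟨r₀, hr₀⟩ := exists_restrictTo_mem_locallyZero b hδ
  rw [← Module.DirectLimit.of_f (hij := le_max_left r r₀)]
  refine (congrArg _ ?_).trans (map_zero (Module.DirectLimit.of R _ _ _ _))
  refine (Submodule.Quotient.mk_eq_zero _).2 (mem_asReducedBoundaries_iff.2
    ⟨_, restrictTo_mem_augmentedBoundaries _ hβ, ?_⟩)
  refine ((Submodule.Quotient.eq _).2 ?_).symm
  convert hr₀ (max r r₀) (le_max_right _ _) using 1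
  exact add_sub_cancel_right (restrictTo R _ n δ) (restrictTo R _ n β)

theorem range_atInfinityExtend (b : X) (n : ℕ) :
    LinearMap.range (atInfinityExtend R b n) =
      ((zeroAtInfinity R X (n + 1)).comap (coboundary R X n)).map (Submodule.mkQ _) := by
  apply le_antisymm
  · rintro _ ⟨x, rfl⟩
    obtain ⟨r, x, rfl⟩ := Module.DirectLimit.exists_of x
    obtain ⟨φ, hφ, rfl⟩ := exists_reducedAS_rep x
    refine ⟨φ, mem_zeroAtInfinity_of_restrictTo (b := b) (r := r)
      ((Submodule.Quotient.mk_eq_zero _).1 hφ), ?_⟩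
    rw [atInfinityExtend, Module.DirectLimit.lift_of]
    exact (asExtend_mk_restrictTo b r φ).symm
  · rintro _ ⟨φ, hφ, rfl⟩
    obtain ⟨r, hr⟩ := exists_restrictTo_mem_locallyZero b hφ
    refine ⟨Module.DirectLimit.of R _ _ _ r (Submodule.Quotient.mk
      ⟨Submodule.Quotient.mk (restrictTo R _ n φ),
        (Submodule.Quotient.mk_eq_zero _).2 (hr r le_rfl)⟩), ?_⟩
    rw [atInfinityExtend, Module.DirectLimit.lift_of]
    exact asExtend_mk_restrictTo b r φ

/-! ### The connecting map onto coarse cohomology -/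

variable (R X) in
/-- Cochains with coarse coboundary. -/
abbrev coarseClosed (n : ℕ) : Submodule R (Cochain R X n) :=
  (coarseCochain R X (n + 1)).comap (coboundary R X n)

variable (R X) in
/-- The connecting map sending `φ` to the class of its coboundary. -/
def toHX (n : ℕ) : coarseClosed R X n →ₗ[R] HX R X (n + 1) :=
  (Submodule.mkQ _).comp (LinearMap.codRestrict (LinearMap.ker (coarseD R X (n + 1)))
    (LinearMap.restrict (coboundary R X n) fun _ h => h)
      fun φ => Subtype.ext (coboundary_coboundary φ.1))

theorem toHX_surjective [Nonempty X] (n : ℕ) : Function.Surjective (toHX R X n) := by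
  intro x
  obtain ⟨⟨⟨ψ, hψ⟩, hd⟩, rfl⟩ := Submodule.Quotient.mk_surjective _ x
  obtain ⟨φ, rfl⟩ := coboundary_eq_zero_iff.1 (congrArg Subtype.val hd)
  exact ⟨⟨φ, hψ⟩, rfl⟩

theorem toHX_eq_zero_iff {n : ℕ} (φ : coarseClosed R X n) :
    toHX R X n φ = 0 ↔
      ∃ ψ ∈ coarseCochain R X n, coboundary R X n ψ = coboundary R X n φ := by
  refine (Submodule.Quotient.mk_eq_zero _).trans ⟨?_, ?_⟩
  · rintro ⟨ψ, h⟩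
    exact ⟨ψ.1, ψ.2, congrArg Subtype.val h⟩
  · rintro ⟨ψ, hψ, h⟩
    exact ⟨⟨ψ, hψ⟩, Subtype.ext h⟩

/-- By acyclicity the left kernel is `coarseClosed` intersected with coarse cochains plus augmented
coboundaries. Replacing coarse by locally zero at infinity adds nothing: such a summand has coarse
coboundary, so it can be made coarse without changing that coboundary. -/
theorem ker_toHX [Nonempty X] (hc : UniformlyContractibleAtInfinity X) (n : ℕ) :
    LinearMap.ker (toHX R X n) = LinearMap.ker ((Submodule.mkQ
      (zeroAtInfinity R X n ⊔ augmentedBoundaries R X n)).comp (coarseClosed R X n).subtype) := by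
  ext φ
  rw [LinearMap.mem_ker, LinearMap.mem_ker, toHX_eq_zero_iff]
  refine Iff.trans ?_ (Submodule.Quotient.mk_eq_zero _).symm
  rw [Submodule.subtype_apply, Submodule.mem_sup]
  constructor
  · rintro ⟨ψ, hψ, h⟩
    refine ⟨ψ, coarseCochain_le_zeroAtInfinity n hψ, φ.1 - ψ, coboundary_eq_zero_iff.1 ?_,
      add_sub_cancel _ _⟩
    rw [map_sub, h, sub_self]
  · rintro ⟨δ, hδ, β, hβ, h⟩
    have hd : coboundary R X n δ = coboundary R X n φ.1 := by
      rw [← h, map_add, coboundary_eq_zero_iff.2 hβ, add_zero]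
    cases n with
    | zero => exact ⟨δ, zeroAtInfinity_zero_le hδ, hd⟩
    | succ n =>
      obtain ⟨η, -, hη⟩ := exists_sub_coboundary_mem_coarseCochain hc hδ (hd ▸ φ.2)
      refine ⟨_, hη, ?_⟩
      rw [map_sub, coboundary_coboundary, sub_zero, hd]

/-- If `d φ` is locally zero at infinity, it is a cocycle, so `d φ - d η` is coarse for some `η`
locally zero at infinity. Then `φ - η` represents the same class and has coarse coboundary. -/
theorem range_mkQ_coarseClosed [Nonempty X] (hc : UniformlyContractibleAtInfinity X) (n : ℕ) :
    LinearMap.range ((Submodule.mkQ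
      (zeroAtInfinity R X n ⊔ augmentedBoundaries R X n)).comp (coarseClosed R X n).subtype) =
      ((zeroAtInfinity R X (n + 1)).comap (coboundary R X n)).map (Submodule.mkQ _) := by
  apply le_antisymm
  · rintro _ ⟨φ, rfl⟩
    exact ⟨φ.1, coarseCochain_le_zeroAtInfinity _ φ.2, rfl⟩
  · rintro _ ⟨φ, hφ, rfl⟩
    obtain ⟨η, hη, h⟩ := exists_sub_coboundary_mem_coarseCochain hc hφ (by
      rw [coboundary_coboundary]
      exact Submodule.zero_mem _)
    refine ⟨⟨φ - η, ?_⟩, (Submodule.Quotient.eq _).2 (Submodule.mem_sup_left ?_)⟩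
    · rwa [Submodule.mem_comap, map_sub]
    · rw [Submodule.subtype_apply, sub_sub_cancel_left]
      exact Submodule.neg_mem _ hη

/-- A `0`-cocycle is constant, and a coarse one vanishes at far away points, which exist because `X`
is unbounded. -/
theorem subsingleton_HX_zero (hX : ¬ IsBounded (Set.univ : Set X)) :
    Subsingleton (HX R X 0) := by
  refine Submodule.Quotient.subsingleton_iff.2 (Submodule.eq_top_iff'.2 ?_)
  rintro ⟨⟨φ, hφ⟩, hd⟩
  have hX' : (cobounded X).NeBot := ⟨fun h => hX (cobounded_eq_bot_iff.1 h).bounded_univ⟩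
  have : Nonempty X := nonempty_of_neBot (cobounded X)
  obtain ⟨c, rfl⟩ := coboundary_eq_zero_iff.1 (congrArg Subtype.val hd)
  obtain ⟨a, ha⟩ := (mem_coarseCochain_iff.1 hφ 1).exists
  have hc : c = 0 := ha (fun _ => a) fun _ => Metric.mem_ball_self one_pos
  subst hc
  exact Subtype.ext rfl

end Comparison

end CoarseCohomology

theorem mainTheorem4 (R : Type*) [Ring R] (X : Type*) [MetricSpace X]
    (hX : ¬ Bornology.IsBounded (Set.univ : Set X))
    (hc : CoarseCohomology.UniformlyContractibleAtInfinity X) (b : X) :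
    Subsingleton (CoarseCohomology.HX R X 0) ∧
      ∀ n : ℕ, Nonempty
        (CoarseCohomology.HX R X (n + 1) ≃ₗ[R] CoarseCohomology.ReducedASAtInfinity R b n) := by
  have : Nonempty X := ⟨b⟩
  refine ⟨CoarseCohomology.subsingleton_HX_zero hX, fun n => ⟨?_⟩⟩
  exact ((CoarseCohomology.toHX R X n).quotKerEquivOfSurjective
      (CoarseCohomology.toHX_surjective n)).symm ≪≫ₗ
    Submodule.quotEquivOfEq _ _ (CoarseCohomology.ker_toHX hc n) ≪≫ₗ
    LinearMap.quotKerEquivRange _ ≪≫ₗ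
    LinearEquiv.ofEq _ _ ((CoarseCohomology.range_mkQ_coarseClosed hc n).trans
      (CoarseCohomology.range_atInfinityExtend b n).symm) ≪≫ₗ
    (LinearEquiv.ofInjective _ (CoarseCohomology.atInfinityExtend_injective b n)).symm
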